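/- **Conventions.** $\mathbb F_q$ is a finite field and $\psi:\mathbb F_q\to\mathbb C^*$ a nontrivial additive character. A *filtered space* $(I,F,V)$ is an $\mathbb F_q$-vector space $V$ with a partially ordered set $I$ in which any two elements have a common lower and a common upper bound, and an increasing map $F$ from $I$ to subspaces of $V$ with $\bigcap_i F(i)=0$, $\bigcup_i F(i)=V$. A filtration $(I_1,F_1)$ of $V$ *dominates* $(I_2,F_2)$ via an order-preserving $\varphi:I_2\to I_1$ if $F_1(\varphi(i))=F_2(i)$ for all $i\in I_2$ and every $j\in I_1$ satisfies $\varphi(i_1)\le j\le\varphi(i_2)$ for some $i_1,i_2\in I_2$. A *$C_1$-space* is a filtered space with all $F(j)/F(i)$, $i\le j$, finite-dimensional; a *$C_2$-space* is a filtered space with a $C_1$-space structure $E_{i,j}$ on each $F(j)/F(i)$, $i\le j$, such that $0\to E_{i,j}\to E_{i,l}\to E_{j,l}\to0$ is an admissible triple of $C_1$-spaces for $i\le j\le l$. A triple $0\to E_1\xrightarrow{\alpha}E_2\xrightarrow{\beta}E_3\to0$ of $C_1$- or $C_2$-spaces is *admissible* if $0\to V_1\to V_2\to V_3\to0$ is exact,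 $F_1$ dominates $(I_2,F_2(\cdot)\cap V_1)$ via some $\varepsilon:I_2\to I_1$, $F_3$ dominates $(I_2,\beta(F_2(\cdot)))$ via some $\gamma:I_2\to I_3$, and, for $C_2$-spaces, the triples $0\to F_1(\varepsilon(j))/F_1(\varepsilon(i))\to F_2(j)/F_2(i)\to F_3(\gamma(j))/F_3(\gamma(i))\to0$, $i\le j$ in $I_2$, are admissible triples of $C_1$-spaces. For a $C_2$-triple, $\varepsilon$ and $\gamma$ are fixed. A $C_1$-space is *complete* if $V=\varinjlim_i\varprojlim_{j\le i}F(i)/F(j)$; a $C_2$-space is complete if moreover all $E_{i,j}$ are complete. A $C_2$-space is a *$cC_2$-space* if $F(t)=V$ for some $t$ and a *$dC_2$-space* if $F(s)=\{0\}$ for some $s$. **$C_1$-spaces.** For a $C_1$-space $E$: $\check E=(I^{op},F(\cdot)^{\perp},\check V)$, where $\check V\subset V^*$ consists of the functionals that vanish on some $F(i)$; $\mathcal D(E)$ is the space of functions $V\to\mathbb C$ vanishing outside some $F(j)$ and invariant under some $F(i)$; $\mathcal D'(E)=\mathcal D(E)^*$; $\mu(E)\subset\mathcal D'(E)$ is the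 one-dimensional space of translation-invariant elements. There is a perfect pairing $\mu(E)\otimes\mu(\check E)\to\mathbb C$, $m\otimes m'\mapsto m(F(i))\,m'(F(i)^\perp)$ (independent of $i$). For $m\in\mu(\check E)$ put $(\mathbf F_m f)(x)=\int_{\check V} f(w)\overline{\psi(w(x))}\,dm(w)$ for $f\in\mathcal D(\check E)$, and $\mathbf F_m(G)=G\circ\mathbf F_m$ for $G\in\mathcal D'(E)$; this gives $\mathbf F:\mathcal D'(E)\otimes\mu(\check E)\to\mathcal D'(\check E)$. An admissible triple gives the restriction $\alpha^*:\mathcal D(E_2)\to\mathcal D(E_1)$, fibre integration $\beta_*:\mathcal D(E_2)\otimes\mu(E_1)\to\mathcal D(E_3)$, their transposes $\alpha_*:\mathcal D'(E_1)\to\mathcal D'(E_2)$ and $\beta^*:\mathcal D'(E_3)\otimes\mu(E_1)\to\mathcal D'(E_2)$, and the identification $\mu(E_2)=\mu(E_1)\otimes\mu(E_3)$. **$C_2$-spaces.** For a $C_2$-space $E$ let $\mu(F(i)\mid F(j))=\varinjlim_{l\le i,j}\mathrm{Hom}(\mu(F(i)/F(l)),\mu(F(j)/F(l)))$ (virtual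 measures; transition maps $f\mapsto f'$ with $f'(a\otimes c)=f(a)\otimes c$), and for $o\in I$ let $$\mathcal D'_{F(o)}(E)=\varinjlim_{l\le i}\mathcal D'(F(i)/F(l))\otimes\mu(F(o)\mid F(l)),$$ the limit being taken with respect to inverse images along $F(i)/F(l')\to F(i)/F(l)$ for $l'\le l$ and direct images along $F(i)/F(l)\to F(i')/F(l)$ for $i\le i'$. The dual $\check E=(I^{op},F^0,\check V)$ has the subquotients $F^0(j)/F^0(i)=\check E_{j,i}$, the dual of the $C_1$-space $E_{j,i}=F(i)/F(j)$, for $j\le i$, and the spaces $\mu(F^0(i)\mid F^0(j))$ and $\mathcal D'_{F^0(o)}(\check E)$ are formed from these subquotients; $\mu(F(i)\mid F(j))=\mu(F^0(i)\mid F^0(j))$ canonically, by the pairings above. An admissible triple of $C_2$-spaces gives the dual triple $0\to\check E_3\to\check E_2\to\check E_1\to0$, with the functions $\gamma,\varepsilon$ in place of $\varepsilon,\gamma$. The one-dimensional transforms $\mathcal D'(F(i)/F(l))\otimes\mu(F(o)\mid F(l))\to\mathcal D'(F^0(l)/F^0(i))\otimes\mu(F^0(o)\mid F^0(i))$ are compatible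 with the limits and define the two-dimensional Fourier transform $\mathbf F:\mathcal D'_{F(o)}(E)\to\mathcal D'_{F^0(o)}(\check E)$. **The characteristic distribution.** Let $0\to E_1\xrightarrow{\alpha}E_2\xrightarrow{\beta}E_3\to0$ be an admissible triple of $C_2$-spaces, $E_1$ a $cC_2$-space, $E_3$ a $dC_2$-space, $o\in I_2$, $\mu\in\mu(F_1(\varepsilon(o))\mid V_1)$ and $\nu\in\mu(F_3(\gamma(o))\mid\{0\})$. Here $V_1=F_1(t)$ with $t\ge\varepsilon(o)$ and $\{0\}=F_3(s)$ with $s\le\gamma(o)$. Let $\mathbf 1_\mu\in\mathcal D'_{F_1(\varepsilon(o))}(E_1)$ be the class of $\mu\otimes 1$, where $\mu\in\mu(V_1/F_1(\varepsilon(o)))\subset\mathcal D'(V_1/F_1(\varepsilon(o)))$ and $1\in\mu(F_1(\varepsilon(o))\mid F_1(\varepsilon(o)))=\mathbb C$. Since $\mu(F_2(o)\mid F_2(l))=\mu(F_1(\varepsilon(o))\mid F_1(\varepsilon(l)))\otimes\mu(F_3(\gamma(o))\mid\{0\})$ when $F_3(\gamma(l))=\{0\}$, the direct images along $F_1(\varepsilon(i))/F_1(\varepsilon(l))\to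 F_2(i)/F_2(l)$ define in the limit $\alpha_*:\mathcal D'_{F_1(\varepsilon(o))}(E_1)\otimes\mu(F_3(\gamma(o))\mid\{0\})\to\mathcal D'_{F_2(o)}(E_2)$. Put $\delta_{E_1,\mu\otimes\nu}=\alpha_*(\mathbf 1_\mu\otimes\nu)\in\mathcal D'_{F_2(o)}(E_2)$. **Theorem (Poisson formula I).** Let $0\to E_1\to E_2\to E_3\to0$ be an admissible triple of complete $C_2$-spaces over $\mathbb F_q$, where $E_1$ is a $cC_2$-space and $E_3$ is a $dC_2$-space, and let $o\in I_2$. Then for all $\mu\in\mu(F_1(\varepsilon(o))\mid V_1)$ and $\nu\in\mu(F_3(\gamma(o))\mid\{0\})$, $$\mathbf F(\delta_{E_1,\mu\otimes\nu})=\delta_{\check E_3,\nu\otimes\mu}\quad\text{in }\mathcal D'_{F_2^0(o)}(\check E_2).$$ Here the right-hand side is the characteristic distribution of the dual triple $0\to\check E_3\to\check E_2\to\check E_1\to0$ (in which $\check E_3$ is a $cC_2$-space and $\check E_1$ is a $dC_2$-space), with $\nu\in\mu(F_3(\gamma(o))\mid\{0\})=\mu(F_3^0(\gamma(o))\mid\check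 V_3)$ and $\mu\in\mu(F_1(\varepsilon(o))\mid V_1)=\mu(F_1^0(\varepsilon(o))\mid\{0\})$. -/

import Mathlib

universe k u v w u₁ v₁ w₁ u₂ v₂ w₂ u₃ v₃ w₃

noncomputable section

namespace HarmonicC2

open scoped ComplexConjugate

/-- A filtered vector space `(I, F, V)`: `I` is directed in both directions, `F` is increasing,
`⋂ F i = 0` and `⋃ F i = V`. -/
structure FilteredSpace (K : Type k) [Field K] (V : Type u) [AddCommGroup V] [Module K V] where
  I : Type v
  [ord : PartialOrder I]
  F : I → Submodule K V
  mono : Monotone F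
  below : ∀ i j : I, ∃ l, l ≤ i ∧ l ≤ j
  above : ∀ i j : I, ∃ l, i ≤ l ∧ j ≤ l
  inter : ∀ x : V, (∀ i, x ∈ F i) → x = 0
  union : ∀ x : V, ∃ i, x ∈ F i

attribute [instance] FilteredSpace.ord

/-- `V` is the inductive limit over `i` of the projective limits of `F i / F j`, `j ≤ i`, that is,
every compatible family of classes `x j + F j` in `F i / F j` comes from an element of `F i`
(uniqueness and the exhaustion by the `F i` hold in every filtered space). -/
def FilteredSpace.IsComplete {K : Type k} [Field K] {V : Type u} [AddCommGroup V] [Module K V]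
    (E : FilteredSpace.{k, u, v} K V) : Prop :=
  ∀ (i : E.I) (x : E.I → V), (∀ j, j ≤ i → x j ∈ E.F i) →
    (∀ j j', j' ≤ j → j ≤ i → x j' - x j ∈ E.F j) →
    ∃ y ∈ E.F i, ∀ j, j ≤ i → y - x j ∈ E.F j

/-- The filtration `F` (indexed by `I`) dominates the filtration `G` (indexed by `J`) through the
order-preserving function `φ : J → I`. -/
structure DominatesVia {K : Type k} [Field K] {V : Type u} [AddCommGroup V] [Module K V]
    {I : Type v} {J : Type w} [PartialOrder I] [PartialOrder J]
    (F : I → Submodule K V) (G : J → Submodule K V) (φ : J → I) : Prop where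
  mono : Monotone φ
  eq : ∀ j, F (φ j) = G j
  cofinal : ∀ i, ∃ j₁ j₂, φ j₁ ≤ i ∧ i ≤ φ j₂

/-- The structure of a `C₁`-space on the vector space `V`: a filtration with finite-dimensional
subquotients `F j / F i`. -/
structure C1Structure (K : Type k) [Field K] (V : Type u) [AddCommGroup V] [Module K V]
    extends FilteredSpace.{k, u, v} K V where
  fin : ∀ i j : I, i ≤ j → FiniteDimensional K (F j ⧸ (F i).submoduleOf (F j))

/-- A `C₁`-space. -/
structure C1Space (K : Type k) [Field K] where
  V : Type u
  [grp : AddCommGroup V]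
  [mod : Module K V]
  str : C1Structure.{k, u, v} K V

attribute [instance] C1Space.grp C1Space.mod

variable {K : Type k} [Field K]

/-- The index set of the filtration. -/
abbrev C1Space.I (E : C1Space.{k, u, v} K) : Type v := E.str.I

/-- The filtration. -/
abbrev C1Space.F (E : C1Space.{k, u, v} K) : E.I → Submodule K E.V := E.str.F

/-- A `C₁`-structure as a `C₁`-space. -/
abbrev C1Structure.toSpace {V : Type u} [AddCommGroup V] [Module K V]
    (s : C1Structure.{k, u, v} K V) : C1Space.{k, u, v} K := ⟨V, s⟩

instance (E : C1Space.{k, u, v} K) : Nonempty E.I := ⟨(E.str.union 0).choose⟩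

/-- `0 → E₁ → E₂ → E₃ → 0` is an admissible triple of `C₁`-spaces. (The remaining condition, that
the induced triples of finite-dimensional subquotients be exact, is automatic.) -/
structure C1Admissible (E₁ : C1Space.{k, u₁, v₁} K) (E₂ : C1Space.{k, u₂, v₂} K)
    (E₃ : C1Space.{k, u₃, v₃} K) (α : E₁.V →ₗ[K] E₂.V) (β : E₂.V →ₗ[K] E₃.V) : Prop where
  inj : Function.Injective α
  exact : Function.Exact α β
  surj : Function.Surjective β
  sub : ∃ ε : E₂.I → E₁.I, DominatesVia E₁.F (fun i => (E₂.F i).comap α) ε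
  quot : ∃ γ : E₂.I → E₃.I, DominatesVia E₃.F (fun i => (E₂.F i).map β) γ

/-! ### Duality of `C₁`-spaces -/

/-- The space `V̌ ⊆ V*` of functionals that vanish on some member of the filtration. -/
def C1Space.dualCarrier (E : C1Space.{k, u, v} K) : Submodule K (E.V →ₗ[K] K) where
  carrier := {f | ∃ i, ∀ x ∈ E.F i, f x = 0}
  zero_mem' := ⟨Classical.arbitrary _, fun _ _ => rfl⟩
  add_mem' := by
    rintro f g ⟨i, hi⟩ ⟨j, hj⟩
    obtain ⟨l, hli, hlj⟩ := E.str.below i j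
    refine ⟨l, fun x hx => ?_⟩
    simp [hi x (E.str.mono hli hx), hj x (E.str.mono hlj hx)]
  smul_mem' := by
    rintro c f ⟨i, hi⟩
    exact ⟨i, fun x hx => by simp [hi x hx]⟩

/-- The annihilator of `F i` in `V̌`. -/
def C1Space.annih (E : C1Space.{k, u, v} K) (i : E.I) : Submodule K E.dualCarrier where
  carrier := {f | ∀ x ∈ E.F i, f.1 x = 0}
  zero_mem' := fun _ _ => rfl
  add_mem' := by
    intro f g hf hg x hx
    simp [hf x hx, hg x hx]
  smul_mem' := by
    intro c f hf x hx
    simp [hf x hx]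

instance (E : C1Space.{k, u, v} K) : AddCommGroup E.dualCarrier := Submodule.addCommGroup _

instance (E : C1Space.{k, u, v} K) (i : E.I) : AddCommGroup (E.annih i) :=
  Submodule.addCommGroup _

theorem C1Space.annih_fin (E : C1Space.{k, u, v} K) {i j : E.I} (h : j ≤ i) :
    FiniteDimensional K (E.annih j ⧸ (E.annih i).submoduleOf (E.annih j)) := by
  have := E.str.fin j i h
  let r : E.annih j →ₗ[K] Module.Dual K (E.F i ⧸ (E.F j).submoduleOf (E.F i)) :=
    { toFun := fun f => Submodule.liftQ _ (f.1.1.comp (E.F i).subtype)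
        (fun x hx => f.2 _ hx)
      map_add' := fun f g => by
        apply LinearMap.ext; intro x; obtain ⟨x, rfl⟩ := Submodule.mkQ_surjective _ x; rfl
      map_smul' := fun c f => by
        apply LinearMap.ext; intro x; obtain ⟨x, rfl⟩ := Submodule.mkQ_surjective _ x; rfl }
  have hr : LinearMap.ker r = (E.annih i).submoduleOf (E.annih j) := by
    ext f
    constructor
    · intro hf x hx
      exact LinearMap.congr_fun (LinearMap.mem_ker.1 hf) (Submodule.mkQ _ ⟨x, hx⟩)
    · intro hf
      refine LinearMap.mem_ker.2 (LinearMap.ext fun x => ?_)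
      obtain ⟨x, rfl⟩ := Submodule.mkQ_surjective _ x
      exact hf x.1 x.2
  rw [← hr]
  exact Module.Finite.of_injective ((LinearMap.ker r).liftQ r le_rfl)
    (LinearMap.ker_eq_bot.1 (Submodule.ker_liftQ_eq_bot' _ _ rfl))

/-- The dual `C₁`-space `Ě`: the order of the index set is reversed, and the filtration consists
of the annihilators `(F i)^⊥`. -/
def C1Space.dual (E : C1Space.{k, u, v} K) : C1Space.{k, max k u, v} K where
  V := E.dualCarrier
  str :=
    { I := E.Iᵒᵈ
      ord := OrderDual.instPartialOrder E.I
      F := fun i => E.annih (OrderDual.ofDual i)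
      mono := fun _ _ h _ hf x hx => hf x (E.str.mono h hx)
      below := fun i j => E.str.above (OrderDual.ofDual i) (OrderDual.ofDual j)
      above := fun i j => E.str.below (OrderDual.ofDual i) (OrderDual.ofDual j)
      inter := fun f hf => by
        apply Subtype.ext
        apply LinearMap.ext
        intro x
        obtain ⟨i, hi⟩ := E.str.union x
        exact hf (OrderDual.toDual i) x hi
      union := fun f => f.2
      fin := fun _ _ h => E.annih_fin h }

section dualMap

variable {E₁ : C1Space.{k, u₁, v₁} K} {E₂ : C1Space.{k, u₂, v₂} K} {E₃ : C1Space.{k, u₃, v₃} K}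
  {α : E₁.V →ₗ[K] E₂.V} {β : E₂.V →ₗ[K] E₃.V}

/-- The transpose `Ě₂ → Ě₁`, `f ↦ f ∘ α`, of an admissible monomorphism. -/
def C1Admissible.dualInc (h : C1Admissible E₁ E₂ E₃ α β) : E₂.dual.V →ₗ[K] E₁.dual.V :=
  LinearMap.codRestrict E₁.dualCarrier (α.dualMap.comp E₂.dualCarrier.subtype) (by
    rintro ⟨f, i, hi⟩
    obtain ⟨ε, hε⟩ := h.sub
    refine ⟨ε i, fun x hx => hi _ ?_⟩
    rw [hε.eq] at hx
    exact hx)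

/-- The transpose `Ě₃ → Ě₂`, `f ↦ f ∘ β`, of an admissible epimorphism. -/
def C1Admissible.dualPrj (h : C1Admissible E₁ E₂ E₃ α β) : E₃.dual.V →ₗ[K] E₂.dual.V :=
  LinearMap.codRestrict E₂.dualCarrier (β.dualMap.comp E₃.dualCarrier.subtype) (by
    rintro ⟨f, i, hi⟩
    obtain ⟨γ, hγ⟩ := h.quot
    obtain ⟨j, -, hj, -⟩ := hγ.cofinal i
    refine ⟨j, fun x hx => hi _ (E₃.str.mono hj ?_)⟩
    change _ ∈ E₃.F (γ j)
    rw [hγ.eq]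
    exact ⟨x, hx, rfl⟩)

theorem exists_extension {V₁ : Type u₁} {V₂ : Type u₂} [AddCommGroup V₁] [Module K V₁]
    [AddCommGroup V₂] [Module K V₂] (α : V₁ →ₗ[K] V₂) (N : Submodule K V₂) (f : Module.Dual K V₁)
    (hf : ∀ x ∈ N.comap α, f x = 0) : ∃ g : Module.Dual K V₂, (∀ x ∈ N, g x = 0) ∧ g ∘ₗ α = f := by
  let a : (V₁ ⧸ N.comap α) →ₗ[K] (V₂ ⧸ N) := Submodule.mapQ _ _ α le_rfl
  have ha : LinearMap.ker a = ⊥ := by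
    rw [Submodule.eq_bot_iff]
    intro x hx
    obtain ⟨x, rfl⟩ := Submodule.mkQ_surjective _ x
    have hx' : α x ∈ N := (Submodule.Quotient.mk_eq_zero _).1 hx
    exact (Submodule.Quotient.mk_eq_zero _).2 hx'
  obtain ⟨r, hr⟩ := LinearMap.exists_leftInverse_of_injective a ha
  refine ⟨((N.comap α).liftQ f hf).comp (r.comp N.mkQ), fun x hx => ?_, ?_⟩
  · have : N.mkQ x = 0 := (Submodule.Quotient.mk_eq_zero _).2 hx
    simp [this]
  · ext x
    have := LinearMap.congr_fun hr (Submodule.mkQ _ x)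
    change (N.comap α).liftQ f hf (r (a (Submodule.mkQ _ x))) = f x
    change r (a (Submodule.mkQ _ x)) = Submodule.mkQ _ x at this
    rw [this]
    rfl

/-- The dual triple `0 → Ě₃ → Ě₂ → Ě₁ → 0` is admissible. -/
theorem C1Admissible.dual (h : C1Admissible E₁ E₂ E₃ α β) :
    C1Admissible E₃.dual E₂.dual E₁.dual h.dualPrj h.dualInc := by
  obtain ⟨ε, hε⟩ := h.sub
  obtain ⟨γ, hγ⟩ := h.quot
  refine ⟨?_, ?_, ?_, ⟨γ, ?_, ?_, ?_⟩, ⟨ε, ?_, ?_, ?_⟩⟩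
  · intro f g hfg
    apply Subtype.ext
    apply LinearMap.ext
    intro x
    obtain ⟨y, rfl⟩ := h.surj x
    exact LinearMap.congr_fun (congrArg Subtype.val hfg) y
  · intro f
    constructor
    · intro hf
      have hf' : ∀ x, f.1 (α x) = 0 := fun x => LinearMap.congr_fun (congrArg Subtype.val hf) x
      have hk : LinearMap.ker β ≤ LinearMap.ker f.1 := by
        intro y hy
        obtain ⟨x, rfl⟩ := (h.exact y).1 hy
        exact hf' x
      obtain ⟨s, hs⟩ := LinearMap.exists_rightInverse_of_surjective β (LinearMap.range_eq_top.2 h.surj)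
      have hs' : ∀ y, f.1 (s (β y)) = f.1 y := by
        intro y
        have : s (β y) - y ∈ LinearMap.ker β := by
          have := LinearMap.congr_fun hs (β y)
          simp only [LinearMap.comp_apply, LinearMap.id_apply] at this
          simp [this]
        have := hk this
        rw [LinearMap.mem_ker, map_sub, sub_eq_zero] at this
        exact this
      refine ⟨⟨f.1.comp s, ?_⟩, ?_⟩
      · obtain ⟨i, hi⟩ := f.2
        refine ⟨γ i, fun x hx => ?_⟩
        rw [hγ.eq] at hx
        obtain ⟨y, hy, rfl⟩ := hx
        exact (hs' y).trans (hi y hy)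
      · apply Subtype.ext
        apply LinearMap.ext
        exact hs'
    · rintro ⟨g, rfl⟩
      apply Subtype.ext
      apply LinearMap.ext
      intro x
      have : β (α x) = 0 := (h.exact _).2 ⟨x, rfl⟩
      change g.1 (β (α x)) = 0
      rw [this, map_zero]
  · rintro ⟨f, i, hi⟩
    obtain ⟨j, -, hj, -⟩ := hε.cofinal i
    obtain ⟨g, hg, hgf⟩ := exists_extension α (E₂.F j) f (fun x hx => hi x (E₁.str.mono hj (by
      change _ ∈ E₁.F (ε j)
      rw [hε.eq]; exact hx)))
    exact ⟨⟨g, j, hg⟩, Subtype.ext hgf⟩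
  · exact fun _ _ hij => hγ.mono hij
  · intro i
    ext f
    constructor
    · intro hf x hx
      refine hf _ ?_
      change β x ∈ E₃.F (γ (OrderDual.ofDual i))
      rw [hγ.eq]
      exact ⟨x, hx, rfl⟩
    · intro hf x hx
      change x ∈ E₃.F (γ (OrderDual.ofDual i)) at hx
      rw [hγ.eq] at hx
      obtain ⟨y, hy, rfl⟩ := hx
      exact hf y hy
  · intro i
    obtain ⟨j₁, j₂, h₁, h₂⟩ := hγ.cofinal i
    exact ⟨j₂, j₁, h₂, h₁⟩
  · exact fun _ _ hij => hε.mono hij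
  · intro i
    ext f
    constructor
    · intro hf
      obtain ⟨g, hg, hgf⟩ := exists_extension α (E₂.F (OrderDual.ofDual i)) f.1
        (fun x hx => hf x (by
          change x ∈ E₁.F (ε (OrderDual.ofDual i))
          rw [hε.eq]; exact hx))
      exact ⟨⟨g, i, hg⟩, hg, Subtype.ext hgf⟩
    · rintro ⟨g, hg, rfl⟩ x hx
      change x ∈ E₁.F (ε (OrderDual.ofDual i)) at hx
      rw [hε.eq] at hx
      exact hg _ hx
  · intro i
    obtain ⟨j₁, j₂, h₁, h₂⟩ := hε.cofinal i
    exact ⟨j₂, j₁, h₂, h₁⟩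

end dualMap

/-! ### Functions, distributions and invariant measures on a `C₁`-space -/

/-- The space `𝓓(E)` of locally constant functions with compact support. -/
def TestFun (E : C1Space.{k, u, v} K) : Submodule ℂ (E.V → ℂ) where
  carrier := {f | (∃ j, ∀ x, x ∉ E.F j → f x = 0) ∧ ∃ i, ∀ y ∈ E.F i, ∀ x, f (x + y) = f x}
  zero_mem' := ⟨⟨Classical.arbitrary _, fun _ _ => rfl⟩, Classical.arbitrary _, fun _ _ _ => rfl⟩
  add_mem' := by
    rintro f g ⟨⟨j, hj⟩, i, hi⟩ ⟨⟨j', hj'⟩, i', hi'⟩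
    obtain ⟨l, hl, hl'⟩ := E.str.above j j'
    obtain ⟨n, hn, hn'⟩ := E.str.below i i'
    refine ⟨⟨l, fun x hx => ?_⟩, n, fun y hy x => ?_⟩
    · simp [hj x (fun h => hx (E.str.mono hl h)), hj' x (fun h => hx (E.str.mono hl' h))]
    · simp [hi y (E.str.mono hn hy) x, hi' y (E.str.mono hn' hy) x]
  smul_mem' := by
    rintro c f ⟨⟨j, hj⟩, i, hi⟩
    exact ⟨⟨j, fun x hx => by simp [hj x hx]⟩, i, fun y hy x => by simp [hi y hy x]⟩

/-- The space `𝓓'(E)` of distributions. -/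
abbrev Distr (E : C1Space.{k, u, v} K) : Type _ := TestFun E →ₗ[ℂ] ℂ

theorem TestFun.ext' {E : C1Space.{k, u, v} K} {f g : TestFun E} (h : ∀ x, f.1 x = g.1 x) : f = g :=
  Subtype.ext (funext h)

/-- Translation of functions, `(T_a f)(x) = f (x + a)`. -/
def translate (E : C1Space.{k, u, v} K) (a : E.V) (f : TestFun E) : TestFun E :=
  ⟨fun x => f.1 (x + a), by
    obtain ⟨⟨j, hj⟩, i, hi⟩ := f.2
    obtain ⟨n, hn⟩ := E.str.union a
    obtain ⟨l, hl, hl'⟩ := E.str.above j n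
    refine ⟨⟨l, fun x hx => hj _ fun h => hx ?_⟩, i, fun y hy x => ?_⟩
    · have := (E.F l).sub_mem (E.str.mono hl h) (E.str.mono hl' hn)
      rwa [add_sub_cancel_right] at this
    · change f.1 (x + y + a) = f.1 (x + a)
      rw [add_right_comm]
      exact hi y hy _⟩

/-- The space `μ(E)` of invariant measures. -/
def Meas (E : C1Space.{k, u, v} K) : Submodule ℂ (Distr E) where
  carrier := {m | ∀ a f, m (translate E a f) = m f}
  zero_mem' := fun _ _ => rfl
  add_mem' := by
    intro m n hm hn a f
    simp [hm a f, hn a f]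
  smul_mem' := by
    intro c m hm a f
    simp [hm a f]

open scoped Classical in
/-- The characteristic function of `F i`. -/
def ind (E : C1Space.{k, u, v} K) (i : E.I) : TestFun E :=
  ⟨fun x => if x ∈ E.F i then 1 else 0, ⟨i, fun _ hx => if_neg hx⟩, i, fun y hy x => by
    have : x + y ∈ E.F i ↔ x ∈ E.F i := (E.F i).add_mem_iff_left hy
    simp [this]⟩

theorem ind_of_mem {E : C1Space.{k, u, v} K} {i : E.I} {x : E.V} (h : x ∈ E.F i) :
    (ind E i).1 x = 1 := if_pos h

theorem ind_of_notMem {E : C1Space.{k, u, v} K} {i : E.I} {x : E.V} (h : x ∉ E.F i) :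
    (ind E i).1 x = 0 := if_neg h

/-- The value `m (F i)` of an invariant measure at a fixed, arbitrarily chosen, member `F i` of the
filtration. -/
def mass {E : C1Space.{k, u, v} K} (m : Meas E) : ℂ := m.1 (ind E (Classical.arbitrary E.I))

theorem testFun_eq_of_sub_mem {E : C1Space.{k, u, v} K} {i : E.I} {f : E.V → ℂ} (hf : ∀ y ∈ E.F i, ∀ x, f (x + y) = f x)
    {x x' : E.V} (h : x' - x ∈ E.F i) : f x' = f x := by
  have := hf _ h x
  rwa [add_sub_cancel] at this

theorem out_sub_mem {E : C1Space.{k, u, v} K} {i j : E.I} (x : E.F j) :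
    ((Quotient.out (Submodule.Quotient.mk (p := (E.F i).submoduleOf (E.F j)) x) : E.F j) : E.V) - x
      ∈ E.F i := by
  have := (Submodule.Quotient.eq ((E.F i).submoduleOf (E.F j))).1
    (Quotient.out_eq (Submodule.Quotient.mk (p := (E.F i).submoduleOf (E.F j)) x))
  exact this

section Line

variable [Finite K] {E : C1Space.{k, u, v} K}

theorem finite_subquot {i j : E.I} (h : i ≤ j) :
    Finite (E.F j ⧸ (E.F i).submoduleOf (E.F j)) := by
  have := E.str.fin i j h
  exact Module.finite_of_finite K

/-- The sum of `f` over representatives of `F j / F i`. -/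
def cosetSum (E : C1Space.{k, u, v} K) (i j : E.I) (f : TestFun E) : ℂ :=
  ∑ᶠ q : E.F j ⧸ (E.F i).submoduleOf (E.F j), f.1 (Quotient.out q : E.F j)

theorem cosetSum_ind_ne_zero {i j p : E.I} (hip : i ≤ p) (hpj : p ≤ j) :
    cosetSum E i j (ind E p) ≠ 0 := by
  have := finite_subquot (hip.trans hpj)
  have := Fintype.ofFinite (E.F j ⧸ (E.F i).submoduleOf (E.F j))
  classical
  rw [cosetSum, finsum_eq_sum_of_fintype]
  have : ∀ q : E.F j ⧸ (E.F i).submoduleOf (E.F j), (ind E p).1 (Quotient.out q : E.F j) =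
      ((if ((Quotient.out q : E.F j) : E.V) ∈ E.F p then 1 else 0 : ℕ) : ℂ) := by
    intro q
    by_cases h : ((Quotient.out q : E.F j) : E.V) ∈ E.F p
    · rw [ind_of_mem h, if_pos h, Nat.cast_one]
    · rw [ind_of_notMem h, if_neg h, Nat.cast_zero]
  rw [Finset.sum_congr rfl fun q _ => this q, ← Nat.cast_sum, Nat.cast_ne_zero]
  refine (Finset.sum_pos' (fun _ _ => Nat.zero_le _) ⟨Submodule.Quotient.mk 0, Finset.mem_univ _, ?_⟩).ne'
  have h0 := E.str.mono hip (out_sub_mem (i := i) (0 : E.F j))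
  rw [ZeroMemClass.coe_zero, sub_zero] at h0
  rw [if_pos h0]
  exact one_pos

theorem testFun_eq_sum {i j : E.I} (hij : i ≤ j) (f : TestFun E)
    (hj : ∀ x, x ∉ E.F j → f.1 x = 0) (hi : ∀ y ∈ E.F i, ∀ x, f.1 (x + y) = f.1 x) :
    f = ∑ᶠ q : E.F j ⧸ (E.F i).submoduleOf (E.F j),
      f.1 (Quotient.out q : E.F j) • translate E (-(Quotient.out q : E.F j)) (ind E i) := by
  have := finite_subquot hij
  have := Fintype.ofFinite (E.F j ⧸ (E.F i).submoduleOf (E.F j))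
  rw [finsum_eq_sum_of_fintype]
  apply TestFun.ext'
  intro x
  rw [AddSubmonoidClass.coe_finsetSum, Finset.sum_apply]
  change f.1 x = ∑ q : E.F j ⧸ (E.F i).submoduleOf (E.F j),
    f.1 (Quotient.out q : E.F j) * (ind E i).1 (x + -(Quotient.out q : E.F j))
  by_cases hx : x ∈ E.F j
  · rw [Finset.sum_eq_single (Submodule.Quotient.mk ⟨x, hx⟩ :
      E.F j ⧸ (E.F i).submoduleOf (E.F j))]
    · have h := out_sub_mem (i := i) (⟨x, hx⟩ : E.F j)
      rw [testFun_eq_of_sub_mem hi h, ind_of_mem, mul_one]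
      have h' := (E.F i).neg_mem h
      rwa [neg_sub, sub_eq_add_neg] at h'
    · intro q _ hq
      rw [ind_of_notMem, mul_zero]
      intro h
      apply hq
      rw [← Quotient.out_eq q]
      refine ((Submodule.Quotient.eq _).2 ?_).symm
      change x - _ ∈ E.F i
      rwa [sub_eq_add_neg]
    · exact fun h => absurd (Finset.mem_univ _) h
  · rw [hj x hx, Finset.sum_eq_zero]
    intro q _
    rw [ind_of_notMem, mul_zero]
    intro h
    apply hx
    have := (E.F j).add_mem (E.str.mono hij h) (Quotient.out q : E.F j).2
    rwa [neg_add_cancel_right] at this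

theorem Meas.apply_eq {i j : E.I} (hij : i ≤ j) (m : Meas E) (f : TestFun E)
    (hj : ∀ x, x ∉ E.F j → f.1 x = 0) (hi : ∀ y ∈ E.F i, ∀ x, f.1 (x + y) = f.1 x) :
    m.1 f = cosetSum E i j f * m.1 (ind E i) := by
  have := finite_subquot hij
  have := Fintype.ofFinite (E.F j ⧸ (E.F i).submoduleOf (E.F j))
  conv_lhs => rw [testFun_eq_sum hij f hj hi]
  rw [cosetSum, finsum_eq_sum_of_fintype, finsum_eq_sum_of_fintype, map_sum, Finset.sum_mul]
  refine Finset.sum_congr rfl fun q _ => ?_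
  rw [map_smul, m.2, smul_eq_mul]

theorem Meas.ind_eq_zero_iff {i j : E.I} (h : i ≤ j) (m : Meas E) :
    m.1 (ind E i) = 0 ↔ m.1 (ind E j) = 0 := by
  have := Meas.apply_eq h m (ind E j) (fun x hx => ind_of_notMem hx) (fun y hy x => by
    have hy' := E.str.mono h hy
    have : x + y ∈ E.F j ↔ x ∈ E.F j := (E.F j).add_mem_iff_left hy'
    by_cases hx : x ∈ E.F j
    · rw [ind_of_mem hx, ind_of_mem (this.2 hx)]
    · rw [ind_of_notMem hx, ind_of_notMem (fun h => hx (this.1 h))])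
  rw [this]
  simp [cosetSum_ind_ne_zero h le_rfl]

theorem Meas.eq_zero_of_ind {p : E.I} (m : Meas E) (h : m.1 (ind E p) = 0) : m = 0 := by
  apply Subtype.ext
  apply LinearMap.ext
  intro f
  obtain ⟨⟨j, hj⟩, i, hi⟩ := f.2
  obtain ⟨l, hl, hl'⟩ := E.str.below i j
  obtain ⟨n, hn, hn'⟩ := E.str.below l p
  rw [Meas.apply_eq (hn.trans hl') m f hj (fun y hy => hi y (E.str.mono (hn.trans hl) hy)),
    (Meas.ind_eq_zero_iff hn' m).2 h, mul_zero]
  rfl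

theorem Meas.ind_ne_zero {m : Meas E} (h : m ≠ 0) (p : E.I) : m.1 (ind E p) ≠ 0 :=
  fun h' => h (Meas.eq_zero_of_ind m h')

theorem mass_ne_zero {m : Meas E} (h : m ≠ 0) : mass m ≠ 0 := Meas.ind_ne_zero h _

theorem Meas.eq_smul {b : Meas E} (hb : b ≠ 0) (m : Meas E) : m = (mass m / mass b) • b := by
  have hb' := mass_ne_zero hb
  rw [← sub_eq_zero]
  refine Meas.eq_zero_of_ind (p := Classical.arbitrary _) _ ?_
  change mass m - (mass m / mass b) * mass b = 0
  rw [div_mul_cancel₀ _ hb', sub_self]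

variable (E) in
theorem exists_meas (p : E.I) : ∃ m : Meas E, m.1 (ind E p) = 1 := by
  let N : Submodule ℂ (TestFun E) :=
    { carrier := {f | ∃ i₀ j₀, ∀ i j, i ≤ i₀ → j₀ ≤ j → i ≤ j → cosetSum E i j f = 0}
      zero_mem' := ⟨p, p, fun i j _ _ _ => by
        change (∑ᶠ q : E.F j ⧸ (E.F i).submoduleOf (E.F j), (0 : ℂ)) = 0
        exact finsum_zero⟩
      add_mem' := by
        rintro f g ⟨i₀, j₀, h⟩ ⟨i₁, j₁, h'⟩
        obtain ⟨a, ha, ha'⟩ := E.str.below i₀ i₁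
        obtain ⟨b, hb, hb'⟩ := E.str.above j₀ j₁
        refine ⟨a, b, fun i j hi hj hij => ?_⟩
        have := finite_subquot hij
        have e : cosetSum E i j (f + g) = cosetSum E i j f + cosetSum E i j g :=
          finsum_add_distrib (Set.toFinite _) (Set.toFinite _)
        rw [e, h i j (hi.trans ha) (hb.trans hj) hij, h' i j (hi.trans ha') (hb'.trans hj) hij,
          add_zero]
      smul_mem' := by
        rintro c f ⟨i₀, j₀, h⟩
        refine ⟨i₀, j₀, fun i j hi hj hij => ?_⟩
        have e : cosetSum E i j (c • f) = c • cosetSum E i j f := by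
          have := finite_subquot hij
          have := Fintype.ofFinite (E.F j ⧸ (E.F i).submoduleOf (E.F j))
          rw [cosetSum, cosetSum, finsum_eq_sum_of_fintype, finsum_eq_sum_of_fintype,
            Finset.smul_sum]
          rfl
        rw [e, h i j hi hj hij, smul_zero] }
  have hN : ∀ a f, translate E a f - f ∈ N := by
    intro a f
    obtain ⟨i₀, hi₀⟩ := f.2.2
    obtain ⟨j₀, hj₀⟩ := E.str.union a
    refine ⟨i₀, j₀, fun i j hi hj hij => ?_⟩
    have := finite_subquot hij
    have := Fintype.ofFinite (E.F j ⧸ (E.F i).submoduleOf (E.F j))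
    have hf : ∀ y ∈ E.F i, ∀ x, f.1 (x + y) = f.1 x := fun y hy => hi₀ y (E.str.mono hi hy)
    rw [cosetSum, finsum_eq_sum_of_fintype]
    change ∑ q : E.F j ⧸ (E.F i).submoduleOf (E.F j), (f.1 ((Quotient.out q : E.F j) + a) -
      f.1 (Quotient.out q : E.F j)) = 0
    rw [Finset.sum_sub_distrib, sub_eq_zero]
    let a' : E.F j := ⟨a, E.str.mono hj hj₀⟩
    refine Fintype.sum_equiv (Equiv.addRight (Submodule.Quotient.mk a')) _ _ fun q => ?_
    have hq : q = Submodule.Quotient.mk (Quotient.out q) := (Quotient.out_eq q).symm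
    have h := out_sub_mem (i := i) (Quotient.out q + a')
    rw [Submodule.Quotient.mk_add, ← hq] at h
    exact (testFun_eq_of_sub_mem hf h).symm
  have hp : ind E p ∉ N := by
    rintro ⟨i₀, j₀, h⟩
    obtain ⟨i, hi, hip⟩ := E.str.below i₀ p
    obtain ⟨j, hj, hpj⟩ := E.str.above j₀ p
    exact cosetSum_ind_ne_zero hip hpj (h i j hi hj (hip.trans hpj))
  obtain ⟨m, hm, hmN⟩ := Submodule.exists_le_ker_of_notMem hp
  refine ⟨(m (ind E p))⁻¹ • ⟨m, fun a f => ?_⟩, inv_mul_cancel₀ hm⟩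
  have := hmN (hN a f)
  rwa [LinearMap.mem_ker, map_sub, sub_eq_zero] at this

/-- A nonzero invariant measure. -/
def haar (E : C1Space.{k, u, v} K) : Meas E := (exists_meas E (Classical.arbitrary _)).choose

theorem mass_haar (E : C1Space.{k, u, v} K) : mass (haar E) = 1 :=
  (exists_meas E (Classical.arbitrary _)).choose_spec

theorem haar_ne_zero (E : C1Space.{k, u, v} K) : haar E ≠ 0 := by
  intro h
  have := mass_haar E
  rw [h] at this
  exact zero_ne_one this

end Line

theorem mass_smul {E : C1Space.{k, u, v} K} (c : ℂ) (m : Meas E) : mass (c • m) = c * mass m := rfl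

/-! ### Restriction, integration along fibres, products of measures -/

section Triple

variable {E₁ : C1Space.{k, u₁, v₁} K} {E₂ : C1Space.{k, u₂, v₂} K} {E₃ : C1Space.{k, u₃, v₃} K}
  {α : E₁.V →ₗ[K] E₂.V} {β : E₂.V →ₗ[K] E₃.V}

/-- The function `(T_x f)|_{V₁}`, that is `y ↦ f (x + α y)`. -/
def C1Admissible.fibre (h : C1Admissible E₁ E₂ E₃ α β) (x : E₂.V) : TestFun E₂ →ₗ[ℂ] TestFun E₁ where
  toFun f := ⟨fun y => f.1 (x + α y), by
    obtain ⟨ε, hε⟩ := h.sub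
    obtain ⟨⟨j, hj⟩, i, hi⟩ := f.2
    obtain ⟨n, hn⟩ := E₂.str.union x
    obtain ⟨l, hl, hl'⟩ := E₂.str.above j n
    refine ⟨⟨ε l, fun y hy => hj _ fun hm => hy ?_⟩, ε i, fun z hz y => ?_⟩
    · rw [hε.eq]
      have := (E₂.F l).sub_mem (E₂.str.mono hl hm) (E₂.str.mono hl' hn)
      rwa [add_sub_cancel_left] at this
    · rw [hε.eq] at hz
      change f.1 (x + α (y + z)) = f.1 (x + α y)
      rw [map_add, ← add_assoc]
      exact hi _ hz _⟩
  map_add' _ _ := rfl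
  map_smul' _ _ := rfl

/-- The restriction `α^* : 𝓓(E₂) → 𝓓(E₁)`. -/
def C1Admissible.res (h : C1Admissible E₁ E₂ E₃ α β) : TestFun E₂ →ₗ[ℂ] TestFun E₁ where
  toFun f := ⟨fun y => f.1 (α y), by
    have := (h.fibre 0 f).2
    simpa [C1Admissible.fibre] using this⟩
  map_add' _ _ := rfl
  map_smul' _ _ := rfl

theorem C1Admissible.fibre_congr (h : C1Admissible E₁ E₂ E₃ α β) (c : Meas E₁) (f : TestFun E₂)
    {x x' : E₂.V} (hx : β x = β x') : c.1 (h.fibre x f) = c.1 (h.fibre x' f) := by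
  obtain ⟨z, hz⟩ := (h.exact (x - x')).1 (by rw [map_sub, hx, sub_self])
  rw [← c.2 z (h.fibre x' f)]
  refine congrArg c.1 (TestFun.ext' fun y => ?_)
  change f.1 (x + α y) = f.1 (x' + α (y + z))
  rw [map_add, hz]
  exact congrArg f.1 (by abel)

/-- The direct image `β_* : 𝓓(E₂) ⊗ μ(E₁) → 𝓓(E₃)`: integration along the fibres of `β`,
`(β_* (f ⊗ c)) (β x) = ∫ (T_x f)|_{V₁} dc`. -/
def C1Admissible.push (h : C1Admissible E₁ E₂ E₃ α β) (c : Meas E₁) :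
    TestFun E₂ →ₗ[ℂ] TestFun E₃ where
  toFun f := ⟨fun w => c.1 (h.fibre (Function.surjInv h.surj w) f), by
    obtain ⟨γ, hγ⟩ := h.quot
    obtain ⟨⟨j, hj⟩, i, hi⟩ := f.2
    refine ⟨⟨γ j, fun w hw => ?_⟩, γ i, fun w' hw' w => ?_⟩
    · refine (congrArg c.1 (TestFun.ext' fun y => ?_)).trans (map_zero c.1)
      refine hj _ fun hm => hw ?_
      rw [hγ.eq]
      refine ⟨_, hm, ?_⟩
      rw [map_add, Function.surjInv_eq h.surj, (h.exact _).2 ⟨y, rfl⟩, add_zero]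
    · rw [hγ.eq] at hw'
      obtain ⟨x', hx', rfl⟩ := hw'
      change c.1 (h.fibre _ f) = c.1 (h.fibre _ f)
      rw [h.fibre_congr c f (x' := Function.surjInv h.surj w + x')
        (by rw [map_add, Function.surjInv_eq h.surj, Function.surjInv_eq h.surj])]
      refine congrArg c.1 (TestFun.ext' fun y => ?_)
      change f.1 (_ + x' + α y) = f.1 (_ + α y)
      rw [add_right_comm]
      exact hi _ hx' _⟩
  map_add' f g := by
    apply TestFun.ext'
    intro w
    change c.1 (h.fibre _ (f + g)) = c.1 (h.fibre _ f) + c.1 (h.fibre _ g)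
    rw [map_add, map_add]
  map_smul' a f := by
    apply TestFun.ext'
    intro w
    change c.1 (h.fibre _ (a • f)) = a * c.1 (h.fibre _ f)
    rw [map_smul, map_smul, smul_eq_mul]

theorem C1Admissible.push_apply (h : C1Admissible E₁ E₂ E₃ α β) (c : Meas E₁) (f : TestFun E₂)
    (x : E₂.V) : (h.push c f).1 (β x) = c.1 (h.fibre x f) :=
  h.fibre_congr c f (Function.surjInv_eq h.surj _)

theorem C1Admissible.push_ext (h : C1Admissible E₁ E₂ E₃ α β) {f g : TestFun E₃}
    (hfg : ∀ x, f.1 (β x) = g.1 (β x)) : f = g := by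
  apply TestFun.ext'
  intro w
  obtain ⟨x, rfl⟩ := h.surj w
  exact hfg x

/-- The product measure, `∫ f d(c ⊗ a) = ∫_{V₃} (∫_{V₁} f dc) da`; it is the isomorphism
`μ(E₁) ⊗ μ(E₃) → μ(E₂)` with `(c ⊗ a)(F₂ j) = c (F₂ j ∩ V₁) · a (β (F₂ j))`. -/
def C1Admissible.prod (h : C1Admissible E₁ E₂ E₃ α β) : Meas E₁ →ₗ[ℂ] Meas E₃ →ₗ[ℂ] Meas E₂ :=
  LinearMap.mk₂ ℂ
    (fun c a => ⟨a.1 ∘ₗ h.push c, fun x f => by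
      change a.1 (h.push c (translate E₂ x f)) = a.1 (h.push c f)
      refine (congrArg a.1 (h.push_ext fun y => ?_)).trans (a.2 (β x) (h.push c f))
      change _ = (h.push c f).1 (β y + β x)
      rw [← map_add, h.push_apply, h.push_apply]
      refine congrArg c.1 (TestFun.ext' fun z => ?_)
      change f.1 (y + α z + x) = f.1 (y + x + α z)
      rw [add_right_comm]⟩)
    (fun c c' a => by
      apply Subtype.ext
      apply LinearMap.ext
      intro f
      exact map_add a.1 (h.push c f) (h.push c' f))
    (fun t c a => by
      apply Subtype.ext
      apply LinearMap.ext
      intro f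
      exact map_smul a.1 t (h.push c f))
    (fun _ _ _ => rfl)
    (fun _ _ _ => rfl)

theorem C1Admissible.prod_apply (h : C1Admissible E₁ E₂ E₃ α β) (c : Meas E₁) (a : Meas E₃)
    (f : TestFun E₂) : (h.prod c a).1 f = a.1 (h.push c f) := rfl

theorem C1Admissible.push_add (h : C1Admissible E₁ E₂ E₃ α β) (c c' : Meas E₁) (f : TestFun E₂) :
    h.push (c + c') f = h.push c f + h.push c' f := rfl

theorem C1Admissible.push_smul (h : C1Admissible E₁ E₂ E₃ α β) (t : ℂ) (c : Meas E₁)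
    (f : TestFun E₂) : h.push (t • c) f = t • h.push c f := rfl

/-- The value of a product of measures on the members of the filtration. -/
theorem C1Admissible.prod_ind (h : C1Admissible E₁ E₂ E₃ α β) (c : Meas E₁) (a : Meas E₃)
    {i : E₂.I} {i₁ : E₁.I} {i₃ : E₃.I} (h₁ : E₁.F i₁ = (E₂.F i).comap α)
    (h₃ : E₃.F i₃ = (E₂.F i).map β) :
    (h.prod c a).1 (ind E₂ i) = c.1 (ind E₁ i₁) * a.1 (ind E₃ i₃) := by
  rw [h.prod_apply, ← smul_eq_mul, ← map_smul]
  refine congrArg a.1 (h.push_ext fun x => ?_)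
  rw [h.push_apply]
  change _ = c.1 (ind E₁ i₁) * (ind E₃ i₃).1 (β x)
  by_cases hx : β x ∈ E₃.F i₃
  · rw [ind_of_mem hx, mul_one]
    rw [h₃] at hx
    obtain ⟨x', hx', hxx⟩ := hx
    rw [h.fibre_congr c _ hxx.symm]
    refine congrArg c.1 (TestFun.ext' fun y => ?_)
    change (ind E₂ i).1 (x' + α y) = _
    by_cases hy : y ∈ E₁.F i₁
    · rw [ind_of_mem hy, ind_of_mem]
      rw [h₁] at hy
      exact add_mem hx' hy
    · rw [ind_of_notMem hy, ind_of_notMem]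
      rw [h₁] at hy
      exact fun h' => hy ((Submodule.add_mem_iff_right _ hx').1 h')
  · rw [ind_of_notMem hx, mul_zero]
    refine (congrArg c.1 (TestFun.ext' fun y => ?_)).trans (map_zero c.1)
    refine ind_of_notMem fun h' => hx ?_
    rw [h₃]
    refine ⟨_, h', ?_⟩
    rw [map_add, (h.exact _).2 ⟨y, rfl⟩, add_zero]

variable [Finite K]

theorem C1Admissible.prod_ne_zero (h : C1Admissible E₁ E₂ E₃ α β) {c : Meas E₁} {a : Meas E₃}
    (hc : c ≠ 0) (ha : a ≠ 0) : h.prod c a ≠ 0 := by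
  obtain ⟨ε, hε⟩ := h.sub
  obtain ⟨γ, hγ⟩ := h.quot
  intro h0
  have := h.prod_ind c a (hε.eq (Classical.arbitrary _)) (hγ.eq (Classical.arbitrary _))
  rw [h0] at this
  exact mul_ne_zero (Meas.ind_ne_zero hc _) (Meas.ind_ne_zero ha _) this.symm

/-- Two linear maps on `μ(E₂)` agree if they agree on one nonzero product (hence on all). -/
theorem Meas.hom_ext {E : C1Space.{k, u, v} K} {M : Type*} [AddCommGroup M] [Module ℂ M]
    {f g : Meas E →ₗ[ℂ] M} {b : Meas E} (hb : b ≠ 0) (h : f b = g b) : f = g := by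
  apply LinearMap.ext
  intro m
  rw [Meas.eq_smul hb m, map_smul, map_smul, h]

end Triple

/-- The linear map `μ(E) → M` with a prescribed value at a nonzero `b`. -/
def Meas.extend {E : C1Space.{k, u, v} K} {M : Type*} [AddCommGroup M] [Module ℂ M]
    (b : Meas E) : M →ₗ[ℂ] Meas E →ₗ[ℂ] M :=
  LinearMap.mk₂ ℂ (fun x m => (mass m / mass b) • x)
    (fun _ _ _ => smul_add _ _ _) (fun _ _ _ => smul_comm _ _ _)
    (fun x m m' => by
      change ((mass m + mass m') / mass b) • x = _
      rw [add_div, add_smul])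
    (fun t x m => by
      change ((t * mass m) / mass b) • x = _
      rw [mul_div_assoc, mul_smul])

theorem Meas.extend_self [Finite K] {E : C1Space.{k, u, v} K} {M : Type*} [AddCommGroup M]
    [Module ℂ M] {b : Meas E} (hb : b ≠ 0) (x : M) : Meas.extend b x b = x := by
  change (mass b / mass b) • x = x
  rw [div_self (mass_ne_zero hb), one_smul]

/-! ### The Fourier transform on a `C₁`-space -/

section Fourier

variable (ψ : AddChar K ℂ)

/-- Multiplication of functions on `Ě` by the complex conjugate of the character
`w ↦ ψ (w x)` of `Ě`, for `x ∈ V`. -/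
def twist (E : C1Space.{k, u, v} K) (x : E.V) : TestFun E.dual →ₗ[ℂ] TestFun E.dual where
  toFun f := ⟨fun w => f.1 w * conj (ψ (w.1 x)), by
    obtain ⟨⟨j, hj⟩, i, hi⟩ := f.2
    obtain ⟨n, hn⟩ := E.str.union x
    obtain ⟨l, hl, hl'⟩ := E.dual.str.below i (OrderDual.toDual n)
    refine ⟨⟨j, fun w hw => ?_⟩, l, fun y hy w => ?_⟩
    · change f.1 w * _ = 0
      rw [hj w hw, zero_mul]
    · have h0 : y.1 x = 0 := E.dual.str.mono hl' hy x hn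
      change f.1 (w + y) * conj (ψ (w.1 x + y.1 x)) = f.1 w * conj (ψ (w.1 x))
      rw [h0, add_zero, hi y (E.dual.str.mono hl hy)]⟩
  map_add' f g := TestFun.ext' fun w => add_mul _ _ _
  map_smul' c f := TestFun.ext' fun w => mul_assoc _ _ _

theorem twist_apply (E : C1Space.{k, u, v} K) (x : E.V) (f : TestFun E.dual) (w : E.dual.V) :
    (twist ψ E x f).1 w = f.1 w * conj (ψ (w.1 x)) := rfl

theorem twist_add (E : C1Space.{k, u, v} K) (x y : E.V) (f : TestFun E.dual) :
    twist ψ E (x + y) f = twist ψ E y (twist ψ E x f) := by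
  refine TestFun.ext' fun w => ?_
  rw [twist_apply, twist_apply, twist_apply, map_add, AddChar.map_add_eq_mul, map_mul, mul_assoc]

theorem exists_char_ne_one {ψ : AddChar K ℂ} (hψ : ψ ≠ 1) {V : Type u} [AddCommGroup V] [Module K V]
    (f : V →ₗ[K] K) (N : Submodule K V) (h : ∃ x ∈ N, f x ≠ 0) :
    ∃ x ∈ N, conj (ψ (f x)) ≠ 1 := by
  obtain ⟨x, hx, hfx⟩ := h
  obtain ⟨a, ha⟩ := (AddChar.ne_one_iff).1 hψ
  refine ⟨(a / f x) • x, N.smul_mem _ hx, ?_⟩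
  rw [map_smul, smul_eq_mul, div_mul_cancel₀ _ hfx]
  intro h
  apply ha
  have := congrArg conj h
  rwa [Complex.conj_conj, map_one] at this

variable {ψ} (hψ : ψ ≠ 1)

theorem exists_annih_ne_zero (E : C1Space.{k, u, v} K) (i : E.I) {x : E.V} (hx : x ∉ E.F i) :
    ∃ w ∈ E.annih i, w.1 x ≠ 0 := by
  obtain ⟨f, hf, hfi⟩ := Submodule.exists_le_ker_of_notMem hx
  exact ⟨⟨f, i, fun y hy => hfi hy⟩, fun y hy => hfi hy, hf⟩

theorem annih_twist {E : C1Space.{k, u, v} K} {i : E.I} (hψ : ψ ≠ 1) {x : E.V} (hx : x ∉ E.F i)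
    (m : Meas E.dual) (f : TestFun E.dual) (hf : ∀ y ∈ E.dual.F (OrderDual.toDual i), ∀ w, f.1 (w + y) = f.1 w) :
    m.1 (twist ψ E x f) = 0 := by
  obtain ⟨w, hw, hwx⟩ := exists_annih_ne_zero E i hx
  obtain ⟨y, hy, hyx⟩ := exists_char_ne_one (V := E.dual.V) hψ
    ((LinearMap.applyₗ x).comp E.dualCarrier.subtype) (E.annih i) ⟨w, hw, hwx⟩
  have h := m.2 y (twist ψ E x f)
  have e : translate E.dual y (twist ψ E x f) = conj (ψ (y.1 x)) • twist ψ E x f := by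
    refine TestFun.ext' fun z => ?_
    change f.1 (z + y) * conj (ψ (z.1 x + y.1 x)) = conj (ψ (y.1 x)) * (f.1 z * conj (ψ (z.1 x)))
    rw [hf y hy, AddChar.map_add_eq_mul, map_mul]
    ring
  rw [e, map_smul, smul_eq_mul] at h
  by_contra h0
  exact hyx (mul_right_cancel₀ h0 (h.trans (one_mul _).symm))

/-- The Fourier transform `𝐅_m : 𝓓(Ě) → 𝓓(E)` for `m ∈ μ(Ě)`,
`(𝐅_m f)(x) = ∫ f(w) * conj (ψ (w x)) dm(w)`, where `V` is viewed in the dual of `V̌`. -/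
def fourierTest (E : C1Space.{k, u, v} K) (m : Meas E.dual) : TestFun E.dual →ₗ[ℂ] TestFun E where
  toFun f := ⟨fun x => m.1 (twist ψ E x f), by
    obtain ⟨⟨j, hj⟩, i, hi⟩ := f.2
    refine ⟨⟨OrderDual.ofDual i, fun x hx => annih_twist hψ hx m f hi⟩, OrderDual.ofDual j,
      fun y hy x => congrArg m.1 (TestFun.ext' fun w => ?_)⟩
    rw [twist_add, twist_apply]
    by_cases hw : w ∈ E.dual.F j
    · have : w.1 y = 0 := hw y hy
      rw [this, AddChar.map_zero_eq_one, map_one, mul_one]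
    · rw [twist_apply, hj w hw, zero_mul, zero_mul]⟩
  map_add' f g := TestFun.ext' fun x => by
    change m.1 (twist ψ E x (f + g)) = m.1 (twist ψ E x f) + m.1 (twist ψ E x g)
    rw [map_add, map_add]
  map_smul' c f := TestFun.ext' fun x => by
    change m.1 (twist ψ E x (c • f)) = c * m.1 (twist ψ E x f)
    rw [map_smul, map_smul, smul_eq_mul]

theorem fourierTest_apply (E : C1Space.{k, u, v} K) (m : Meas E.dual) (f : TestFun E.dual) (x : E.V) :
    (fourierTest hψ E m f).1 x = m.1 (twist ψ E x f) := rfl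

/-- The Fourier transform `𝐅_m : 𝓓'(E) → 𝓓'(Ě)` for `m ∈ μ(Ě)`, `(𝐅_m G)(f) = G (𝐅_m f)`. -/
def fourierDistr (E : C1Space.{k, u, v} K) :
    Meas E.dual →ₗ[ℂ] Distr E →ₗ[ℂ] Distr E.dual :=
  LinearMap.mk₂ ℂ (fun m G => G ∘ₗ fourierTest hψ E m)
    (fun m m' G => by
      apply LinearMap.ext
      intro f
      exact map_add G (fourierTest hψ E m f) (fourierTest hψ E m' f))
    (fun c m G => by
      apply LinearMap.ext
      intro f
      exact map_smul G c (fourierTest hψ E m f))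
    (fun _ _ _ => rfl) (fun _ _ _ => rfl)

theorem fourierDistr_apply (E : C1Space.{k, u, v} K) (m : Meas E.dual) (G : Distr E)
    (f : TestFun E.dual) : fourierDistr hψ E m G f = G (fourierTest hψ E m f) := rfl

/-- The canonical pairing `μ(E) ⊗ μ(Ě) → ℂ`, `m ⊗ m' ↦ m (F i) * m' ((F i)^⊥)`, which does not
depend on `i`; under it `m⁻¹ ∈ μ(Ě)` is the element with `⟨m, m⁻¹⟩ = 1`. -/
def pair {E : C1Space.{k, u, v} K} (m : Meas E) (m' : Meas E.dual) : ℂ :=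
  m.1 (ind E (Classical.arbitrary E.I)) *
    m'.1 (ind E.dual (OrderDual.toDual (Classical.arbitrary E.I)))

theorem pair_smul_left {E : C1Space.{k, u, v} K} (c : ℂ) (m : Meas E) (m' : Meas E.dual) :
    pair (c • m) m' = c * pair m m' := mul_assoc _ _ _

theorem pair_smul_right {E : C1Space.{k, u, v} K} (c : ℂ) (m : Meas E) (m' : Meas E.dual) :
    pair m (c • m') = c * pair m m' := mul_left_comm _ _ _

theorem fourierTest_twist (E : C1Space.{k, u, v} K) (m : Meas E.dual) (f : TestFun E.dual) (x : E.V) :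
    fourierTest hψ E m (twist ψ E x f) = translate E x (fourierTest hψ E m f) := by
  refine TestFun.ext' fun y => ?_
  change m.1 (twist ψ E y (twist ψ E x f)) = m.1 (twist ψ E (y + x) f)
  rw [← twist_add, add_comm]

theorem fourierTest_ind (E : C1Space.{k, u, v} K) (m : Meas E.dual) (i : E.I) :
    fourierTest hψ E m (ind E.dual (OrderDual.toDual i)) =
      m.1 (ind E.dual (OrderDual.toDual i)) • ind E i := by
  refine TestFun.ext' fun x => ?_
  change m.1 (twist ψ E x _) = m.1 _ * (ind E i).1 x
  by_cases hx : x ∈ E.F i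
  · rw [ind_of_mem hx, mul_one]
    refine congrArg m.1 (TestFun.ext' fun w => ?_)
    rw [twist_apply]
    by_cases hw : w ∈ E.dual.F (OrderDual.toDual i)
    · have : w.1 x = 0 := hw x hx
      rw [this, AddChar.map_zero_eq_one, map_one, mul_one]
    · rw [ind_of_notMem hw, zero_mul]
  · rw [ind_of_notMem hx, mul_zero]
    refine annih_twist hψ hx m _ fun y hy w => ?_
    have : w + y ∈ E.dual.F (OrderDual.toDual i) ↔ w ∈ E.dual.F (OrderDual.toDual i) :=
      (E.dual.F (OrderDual.toDual i)).add_mem_iff_left hy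
    by_cases hw : w ∈ E.dual.F (OrderDual.toDual i)
    · rw [ind_of_mem hw, ind_of_mem (this.2 hw)]
    · rw [ind_of_notMem hw, ind_of_notMem (fun h => hw (this.1 h))]

section Triple

variable {E₁ : C1Space.{k, u₁, v₁} K} {E₂ : C1Space.{k, u₂, v₂} K} {E₃ : C1Space.{k, u₃, v₃} K}
  {α : E₁.V →ₗ[K] E₂.V} {β : E₂.V →ₗ[K] E₃.V}

theorem C1Admissible.push_twist (h : C1Admissible E₁ E₂ E₃ α β) (ψ : AddChar K ℂ)
    (d : Meas E₃.dual) (f : TestFun E₂.dual) (x : E₁.V) :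
    h.dual.push d (twist ψ E₂ (α x) f) = twist ψ E₁ x (h.dual.push d f) := by
  refine h.dual.push_ext fun w => ?_
  rw [twist_apply, h.dual.push_apply, h.dual.push_apply, mul_comm, ← smul_eq_mul, ← map_smul]
  refine congrArg d.1 (TestFun.ext' fun z => ?_)
  have h0 : β (α x) = 0 := (h.exact _).2 ⟨x, rfl⟩
  change f.1 (w + h.dualPrj z) * conj (ψ (w.1 (α x) + z.1 (β (α x)))) =
    conj (ψ (w.1 (α x))) * f.1 (w + h.dualPrj z)
  rw [h0, map_zero, add_zero, mul_comm]

theorem C1Admissible.res_fourierTest (h : C1Admissible E₁ E₂ E₃ α β) (d : Meas E₃.dual)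
    (n : Meas E₁.dual) (f : TestFun E₂.dual) :
    h.res (fourierTest hψ E₂ (h.dual.prod d n) f) = fourierTest hψ E₁ n (h.dual.push d f) := by
  refine TestFun.ext' fun x => ?_
  change n.1 (h.dual.push d (twist ψ E₂ (α x) f)) = n.1 (twist ψ E₁ x (h.dual.push d f))
  rw [h.push_twist]

end Triple

variable [Finite K]

theorem inversion_aux (E : C1Space.{k, u, v} K) (c : Meas E) (m : Meas E.dual) (f : TestFun E.dual)
    {i j : E.dual.I} (hij : i ≤ j) (hj : ∀ w, w ∉ E.dual.F j → f.1 w = 0)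
    (hi : ∀ y ∈ E.dual.F i, ∀ w, f.1 (w + y) = f.1 w) :
    c.1 (fourierTest hψ E m f) = f.1 0 * c.1 (fourierTest hψ E m (ind E.dual i)) := by
  have := finite_subquot hij
  have := Fintype.ofFinite (E.dual.F j ⧸ (E.dual.F i).submoduleOf (E.dual.F j))
  let L : TestFun E.dual →ₗ[ℂ] ℂ := c.1 ∘ₗ fourierTest hψ E m
  change L f = f.1 0 * L (ind E.dual i)
  have hL : ∀ w, w ∉ E.dual.F i → L (translate E.dual (-w) (ind E.dual i)) = 0 := by
    intro w hw
    have hw' : ∃ x ∈ E.F (OrderDual.ofDual i), w.1 x ≠ 0 := by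
      by_contra! h
      exact hw h
    obtain ⟨x, hx, hwx⟩ := exists_char_ne_one hψ w.1 _ hw'
    have h1 : L (twist ψ E x (translate E.dual (-w) (ind E.dual i))) =
        L (translate E.dual (-w) (ind E.dual i)) := by
      change c.1 (fourierTest hψ E m (twist ψ E x _)) = c.1 (fourierTest hψ E m _)
      rw [fourierTest_twist, c.2]
    have h2 : twist ψ E x (translate E.dual (-w) (ind E.dual i)) =
        conj (ψ (w.1 x)) • translate E.dual (-w) (ind E.dual i) := by
      refine TestFun.ext' fun z => ?_
      rw [twist_apply]
      change (ind E.dual i).1 (z + -w) * _ = _ * (ind E.dual i).1 (z + -w)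
      by_cases hz : z + -w ∈ E.dual.F i
      · have : z.1 x + -w.1 x = 0 := hz x hx
        rw [ind_of_mem hz, eq_of_sub_eq_zero ((sub_eq_add_neg _ _).trans this), mul_comm]
      · rw [ind_of_notMem hz, zero_mul, mul_zero]
    rw [h2, map_smul, smul_eq_mul] at h1
    by_contra h0
    exact hwx (mul_right_cancel₀ h0 (h1.trans (one_mul _).symm))
  conv_lhs => rw [testFun_eq_sum hij f hj hi]
  rw [finsum_eq_sum_of_fintype, map_sum, Finset.sum_eq_single
    (Submodule.Quotient.mk 0 : E.dual.F j ⧸ (E.dual.F i).submoduleOf (E.dual.F j))]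
  · have h := out_sub_mem (i := i) (0 : E.dual.F j)
    rw [map_smul, smul_eq_mul, testFun_eq_of_sub_mem hi h]
    rw [ZeroMemClass.coe_zero, sub_zero] at h
    refine congrArg (fun t => f.1 0 * L t) (TestFun.ext' fun w => ?_)
    have h' := (E.dual.F i).neg_mem h
    exact (ind E.dual i).2.2.elim fun _ _ => by
      change (ind E.dual i).1 (w + -_) = _
      by_cases hw : w ∈ E.dual.F i
      · rw [ind_of_mem hw, ind_of_mem (add_mem hw h')]
      · rw [ind_of_notMem hw, ind_of_notMem (fun hm => hw ((Submodule.add_mem_iff_left _ h').1 hm))]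
  · intro q _ hq
    rw [map_smul, hL, smul_zero]
    intro hm
    apply hq
    rw [← Quotient.out_eq q]
    refine (Submodule.Quotient.eq _).2 ?_
    rw [sub_zero]
    exact hm
  · exact fun h => absurd (Finset.mem_univ _) h

theorem inversion (E : C1Space.{k, u, v} K) (c : Meas E) (m : Meas E.dual) (f : TestFun E.dual) :
    c.1 (fourierTest hψ E m f) = pair c m * f.1 0 := by
  let p : E.dual.I := OrderDual.toDual (Classical.arbitrary E.I)
  obtain ⟨⟨j, hj⟩, i, hi⟩ := f.2
  obtain ⟨j', hjj, hpj⟩ := E.dual.str.above j p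
  obtain ⟨i', hii, hpi⟩ := E.dual.str.below i p
  have h1 := inversion_aux hψ E c m f (hpi.trans hpj)
    (fun w hw => hj w fun h => hw (E.dual.str.mono hjj h))
    (fun y hy => hi y (E.dual.str.mono hii hy))
  have h2 := inversion_aux hψ E c m (ind E.dual p) hpi
    (fun w hw => ind_of_notMem hw)
    (fun y hy w => by
      have hy' := E.dual.str.mono hpi hy
      by_cases hw : w ∈ E.dual.F p
      · rw [ind_of_mem hw, ind_of_mem (add_mem hw hy')]
      · rw [ind_of_notMem hw,
          ind_of_notMem (fun hm => hw ((Submodule.add_mem_iff_left _ hy').1 hm))])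
  rw [ind_of_mem (zero_mem _), one_mul] at h2
  rw [h1, ← h2, fourierTest_ind, map_smul, smul_eq_mul, mul_comm, mul_comm (m.1 _)]
  rfl

theorem pair_ne_zero {E : C1Space.{k, u, v} K} {m : Meas E} {m' : Meas E.dual} (h : m ≠ 0)
    (hm : m' ≠ 0) : pair m m' ≠ 0 := mul_ne_zero (Meas.ind_ne_zero h _) (Meas.ind_ne_zero hm _)

/-- The measure on `Ě` inverse to `haar E`. -/
def haarInv (E : C1Space.{k, u, v} K) : Meas E.dual :=
  (pair (haar E) (haar E.dual))⁻¹ • haar E.dual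

theorem pair_haarInv (E : C1Space.{k, u, v} K) : pair (haar E) (haarInv E) = 1 := by
  rw [haarInv, pair_smul_right, inv_mul_cancel₀ (pair_ne_zero (haar_ne_zero _) (haar_ne_zero _))]

theorem haarInv_ne_zero (E : C1Space.{k, u, v} K) : haarInv E ≠ 0 :=
  smul_ne_zero (inv_ne_zero (pair_ne_zero (haar_ne_zero _) (haar_ne_zero _))) (haar_ne_zero _)

section Triple

variable {E₁ : C1Space.{k, u₁, v₁} K} {E₂ : C1Space.{k, u₂, v₂} K} {E₃ : C1Space.{k, u₃, v₃} K}
  {α : E₁.V →ₗ[K] E₂.V} {β : E₂.V →ₗ[K] E₃.V}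

theorem C1Admissible.push_fourierTest (h : C1Admissible E₁ E₂ E₃ α β) (c : Meas E₁)
    (y : Meas E₃.dual) (n : Meas E₁.dual) (g : TestFun E₂.dual) :
    h.push c (fourierTest hψ E₂ (h.dual.prod y n) g) =
      pair c n • fourierTest hψ E₃ y (h.dual.res g) := by
  refine h.push_ext fun x => ?_
  rw [h.push_apply]
  have e : h.fibre x (fourierTest hψ E₂ (h.dual.prod y n) g) =
      fourierTest hψ E₁ n (h.dual.push y (twist ψ E₂ x g)) := by
    refine TestFun.ext' fun z => ?_
    change n.1 (h.dual.push y (twist ψ E₂ (x + α z) g)) = n.1 (twist ψ E₁ z _)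
    rw [twist_add, h.push_twist]
  rw [e, inversion]
  change _ = _ * y.1 (twist ψ E₃ (β x) (h.dual.res g))
  congr 1
  have h0 := h.dual.push_apply y (twist ψ E₂ x g) 0
  rw [map_zero] at h0
  rw [h0]
  refine congrArg y.1 (TestFun.ext' fun z => ?_)
  change g.1 (0 + h.dualPrj z) * conj (ψ ((0 + h.dualPrj z).1 x)) =
    g.1 (h.dualPrj z) * conj (ψ (z.1 (β x)))
  rw [zero_add]
  rfl

theorem C1Admissible.pair_prod {ψ : AddChar K ℂ} (hψ : ψ ≠ 1) (h : C1Admissible E₁ E₂ E₃ α β)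
    (c : Meas E₁) (a : Meas E₃) (c' : Meas E₁.dual) (a' : Meas E₃.dual) :
    pair (h.prod c a) (h.dual.prod a' c') = pair c c' * pair a a' := by
  let g := ind E₂.dual (Classical.arbitrary _)
  have hg : g.1 0 = 1 := ind_of_mem (zero_mem _)
  have h1 := inversion hψ E₂ (h.prod c a) (h.dual.prod a' c') g
  rw [h.prod_apply, h.push_fourierTest, map_smul, inversion] at h1
  have hr : (h.dual.res g).1 0 = g.1 0 := congrArg g.1 (map_zero _)
  rw [hr, hg, smul_eq_mul, mul_one, mul_one] at h1
  exact h1.symm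

end Triple

end Fourier

theorem C1Admissible.push_eq_of {E₁ : C1Space.{k, u₁, v₁} K} {E₂ : C1Space.{k, u₂, v₂} K}
    {E₃ : C1Space.{k, u₃, v₃} K} {α : E₁.V →ₗ[K] E₂.V} {β : E₂.V →ₗ[K] E₃.V}
    (h : C1Admissible E₁ E₂ E₃ α β) (c : Meas E₁) {f : TestFun E₂} {g : TestFun E₃}
    (H : ∀ x, c.1 (h.fibre x f) = g.1 (β x)) : h.push c f = g :=
  h.push_ext fun x => (h.push_apply c f x).trans (H x)

section Tensor

variable {E₁ : C1Space.{k, u₁, v₁} K} {E₂ : C1Space.{k, u₂, v₂} K} {E₃ : C1Space.{k, u₃, v₃} K}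
  {α : E₁.V →ₗ[K] E₂.V} {β : E₂.V →ₗ[K] E₃.V} {M : Type w} [AddCommGroup M] [Module ℂ M]
  [Finite K]

/-- The linear map on `μ(E₂) = μ(E₁) ⊗ μ(E₃)` which corresponds to a bilinear map. -/
def C1Admissible.lift (h : C1Admissible E₁ E₂ E₃ α β) :
    (Meas E₁ →ₗ[ℂ] Meas E₃ →ₗ[ℂ] M) →ₗ[ℂ] Meas E₂ →ₗ[ℂ] M :=
  Meas.extend (h.prod (haar E₁) (haar E₃)) ∘ₗ
    LinearMap.applyₗ (haar E₃) ∘ₗ LinearMap.applyₗ (haar E₁)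

theorem C1Admissible.lift_prod (h : C1Admissible E₁ E₂ E₃ α β)
    (B : Meas E₁ →ₗ[ℂ] Meas E₃ →ₗ[ℂ] M) (c : Meas E₁) (a : Meas E₃) :
    h.lift B (h.prod c a) = B c a := by
  rw [Meas.eq_smul (haar_ne_zero E₁) c, Meas.eq_smul (haar_ne_zero E₃) a]
  simp only [map_smul, LinearMap.smul_apply]
  rw [C1Admissible.lift, LinearMap.comp_apply, LinearMap.comp_apply, LinearMap.applyₗ_apply_apply,
    LinearMap.applyₗ_apply_apply,
    Meas.extend_self (h.prod_ne_zero (haar_ne_zero E₁) (haar_ne_zero E₃))]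

theorem C1Admissible.hom_ext (h : C1Admissible E₁ E₂ E₃ α β) {f g : Meas E₂ →ₗ[ℂ] M}
    (H : ∀ c a, f (h.prod c a) = g (h.prod c a)) : f = g :=
  Meas.hom_ext (h.prod_ne_zero (haar_ne_zero E₁) (haar_ne_zero E₃)) (H _ _)

/-- Division by a nonzero `b ∈ μ(E₃)`: the measure `z ∈ μ(E₂)` is taken to the `y ∈ μ(E₁)` with
`y ⊗ b = z`. -/
def C1Admissible.divRight (h : C1Admissible E₁ E₂ E₃ α β) (b : Meas E₃) : Meas E₂ →ₗ[ℂ] Meas E₁ :=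
  Meas.extend (h.prod (haar E₁) b) (haar E₁)

theorem C1Admissible.divRight_prod (h : C1Admissible E₁ E₂ E₃ α β) {b : Meas E₃} (hb : b ≠ 0)
    (y : Meas E₁) : h.divRight b (h.prod y b) = y := by
  rw [Meas.eq_smul (haar_ne_zero E₁) y]
  simp only [map_smul, LinearMap.smul_apply]
  rw [C1Admissible.divRight, Meas.extend_self (h.prod_ne_zero (haar_ne_zero E₁) hb)]

theorem C1Admissible.prod_divRight (h : C1Admissible E₁ E₂ E₃ α β) {b : Meas E₃} (hb : b ≠ 0)
    (z : Meas E₂) : h.prod (h.divRight b z) b = z := by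
  rw [Meas.eq_smul (h.prod_ne_zero (haar_ne_zero E₁) hb) z, map_smul, h.divRight_prod hb, map_smul,
    LinearMap.smul_apply]

end Tensor

/-! ### Systems of subquotients -/

/-- The family of subquotients `E_{i,j} = F j / F i`, `i ≤ j`, of a `C₂`-space, with the admissible
triples `0 → E_{i,j} → E_{i,l} → E_{j,l} → 0` and their compatibilities. The spaces of virtual
measures and of distributions of a `C₂`-space depend only on this family, and the subquotients of
the dual space `Ě` are `F⁰ i / F⁰ j = Ě_{i,j}`, the duals of the `C₁`-spaces `E_{i,j}`. -/
structure C1System (K : Type k) [Field K] where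
  ι : Type v
  [ord : PartialOrder ι]
  below : ∀ i j : ι, ∃ l, l ≤ i ∧ l ≤ j
  above : ∀ i j : ι, ∃ l, i ≤ l ∧ j ≤ l
  obj : ∀ {i j : ι}, i ≤ j → C1Space.{k, u, w} K
  inc : ∀ {i j l : ι} (hij : i ≤ j) (hjl : j ≤ l), (obj hij).V →ₗ[K] (obj (hij.trans hjl)).V
  prj : ∀ {i j l : ι} (hij : i ≤ j) (hjl : j ≤ l), (obj (hij.trans hjl)).V →ₗ[K] (obj hjl).V
  adm : ∀ {i j l : ι} (hij : i ≤ j) (hjl : j ≤ l),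
    C1Admissible (obj hij) (obj (hij.trans hjl)) (obj hjl) (inc hij hjl) (prj hij hjl)
  inc_inc : ∀ {i j l m : ι} (hij : i ≤ j) (hjl : j ≤ l) (hlm : l ≤ m) (x : (obj hij).V),
    inc (hij.trans hjl) hlm (inc hij hjl x) = inc hij (hjl.trans hlm) x
  prj_prj : ∀ {i j l m : ι} (hij : i ≤ j) (hjl : j ≤ l) (hlm : l ≤ m)
    (x : (obj ((hij.trans hjl).trans hlm)).V),
    prj hjl hlm (prj hij (hjl.trans hlm) x) = prj (hij.trans hjl) hlm x
  prj_inc : ∀ {i j l m : ι} (hij : i ≤ j) (hjl : j ≤ l) (hlm : l ≤ m)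
    (x : (obj (hij.trans hjl)).V),
    prj hij (hjl.trans hlm) (inc (hij.trans hjl) hlm x) = inc hjl hlm (prj hij hjl x)

attribute [instance] C1System.ord

/-- The dual system, `Ě_{j,i} = F⁰ j / F⁰ i` for `j ≤ i`, indexed by the opposite set, with the
transposed maps. -/
def C1System.dual (S : C1System.{k, u, v, w} K) : C1System.{k, max k u, v, w} K where
  ι := S.ιᵒᵈ
  ord := OrderDual.instPartialOrder S.ι
  below i j := S.above (OrderDual.ofDual i) (OrderDual.ofDual j)
  above i j := S.below (OrderDual.ofDual i) (OrderDual.ofDual j)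
  obj h := (S.obj (OrderDual.ofDual_le_ofDual.2 h)).dual
  inc hij hjl := (S.adm (OrderDual.ofDual_le_ofDual.2 hjl) (OrderDual.ofDual_le_ofDual.2 hij)).dualPrj
  prj hij hjl := (S.adm (OrderDual.ofDual_le_ofDual.2 hjl) (OrderDual.ofDual_le_ofDual.2 hij)).dualInc
  adm hij hjl := (S.adm (OrderDual.ofDual_le_ofDual.2 hjl) (OrderDual.ofDual_le_ofDual.2 hij)).dual
  inc_inc hij hjl hlm f := Subtype.ext (LinearMap.ext fun x => congrArg f.1
    (S.prj_prj (OrderDual.ofDual_le_ofDual.2 hlm) (OrderDual.ofDual_le_ofDual.2 hjl)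
      (OrderDual.ofDual_le_ofDual.2 hij) x))
  prj_prj hij hjl hlm f := Subtype.ext (LinearMap.ext fun x => congrArg f.1
    (S.inc_inc (OrderDual.ofDual_le_ofDual.2 hlm) (OrderDual.ofDual_le_ofDual.2 hjl)
      (OrderDual.ofDual_le_ofDual.2 hij) x))
  prj_inc hij hjl hlm f := Subtype.ext (LinearMap.ext fun x => congrArg f.1
    (S.prj_inc (OrderDual.ofDual_le_ofDual.2 hlm) (OrderDual.ofDual_le_ofDual.2 hjl)
      (OrderDual.ofDual_le_ofDual.2 hij) x))

namespace C1System

variable (S : C1System.{k, u, v, w} K) {i j l m : S.ι} (hij : i ≤ j) (hjl : j ≤ l) (hlm : l ≤ m)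

/-- The element `i` of the index set, as an element of the opposite set. -/
abbrev op {S : C1System.{k, u, v, w} K} (i : S.ι) : S.dual.ι := OrderDual.toDual i

theorem op_le {S : C1System.{k, u, v, w} K} {i j : S.ι} (h : i ≤ j) : op j ≤ op i := h

theorem push_fibre (c : Meas (S.obj hij)) (f : TestFun (S.obj ((hij.trans hjl).trans hlm)))
    (x : (S.obj ((hij.trans hjl).trans hlm)).V) :
    (S.adm hij hjl).push c ((S.adm (hij.trans hjl) hlm).fibre x f) =
      (S.adm hjl hlm).fibre (S.prj hij (hjl.trans hlm) x) ((S.adm hij (hjl.trans hlm)).push c f) := by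
  refine C1Admissible.push_eq_of _ _ fun y => ?_
  change _ = ((S.adm hij (hjl.trans hlm)).push c f).1 (S.prj hij (hjl.trans hlm) x +
    S.inc hjl hlm (S.prj hij hjl y))
  rw [← S.prj_inc, ← map_add, C1Admissible.push_apply]
  refine congrArg c.1 (TestFun.ext' fun z => ?_)
  change f.1 (x + S.inc _ hlm (y + S.inc hij hjl z)) = f.1 (x + S.inc _ hlm y + S.inc hij _ z)
  rw [map_add, S.inc_inc, add_assoc]

/-- Base change. -/
theorem push_res (c : Meas (S.obj hij)) (f : TestFun (S.obj ((hij.trans hjl).trans hlm))) :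
    (S.adm hij hjl).push c ((S.adm (hij.trans hjl) hlm).res f) =
      (S.adm hjl hlm).res ((S.adm hij (hjl.trans hlm)).push c f) := by
  have h := S.push_fibre hij hjl hlm c f 0
  have e₁ : (S.adm (hij.trans hjl) hlm).fibre 0 f = (S.adm (hij.trans hjl) hlm).res f :=
    TestFun.ext' fun y => congrArg f.1 (zero_add _)
  rw [e₁] at h
  rw [h]
  refine TestFun.ext' fun y => congrArg ((S.adm hij (hjl.trans hlm)).push c f).1 ?_
  rw [map_zero, zero_add]

/-- Transitivity of integration along fibres. -/
theorem push_prod (c : Meas (S.obj hij)) (b : Meas (S.obj hjl))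
    (f : TestFun (S.obj ((hij.trans hjl).trans hlm))) :
    (S.adm (hij.trans hjl) hlm).push ((S.adm hij hjl).prod c b) f =
      (S.adm hjl hlm).push b ((S.adm hij (hjl.trans hlm)).push c f) := by
  refine C1Admissible.push_eq_of _ _ fun x => ?_
  rw [C1Admissible.prod_apply, S.push_fibre, ← S.prj_prj hij hjl hlm, C1Admissible.push_apply]

theorem prod_assoc (c : Meas (S.obj hij)) (b : Meas (S.obj hjl)) (a : Meas (S.obj hlm)) :
    (S.adm (hij.trans hjl) hlm).prod ((S.adm hij hjl).prod c b) a =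
      (S.adm hij (hjl.trans hlm)).prod c ((S.adm hjl hlm).prod b a) := by
  refine Subtype.ext (LinearMap.ext fun f => ?_)
  rw [C1Admissible.prod_apply, C1Admissible.prod_apply, C1Admissible.prod_apply, S.push_prod]

theorem res_res (f : TestFun (S.obj ((hij.trans hjl).trans hlm))) :
    (S.adm hij hjl).res ((S.adm (hij.trans hjl) hlm).res f) =
      (S.adm hij (hjl.trans hlm)).res f :=
  TestFun.ext' fun x => congrArg f.1 (S.inc_inc hij hjl hlm x)

end C1System

/-! ### The spaces `𝓓'_{F(o)}(E)` -/

namespace C1System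

variable (S : C1System.{k, u, v, w} K)

/-- The pairs `(l, i)` with `l ≤ o ≤ i`, ordered by `(l, i) ≤ (l', i')` iff `l' ≤ l` and
`i ≤ i'`. -/
abbrev Level (o : S.ι) : Type v := {p : S.ιᵒᵈ × S.ι // OrderDual.ofDual p.1 ≤ o ∧ o ≤ p.2}

variable {S}

/-- The level `(l, i)`. -/
abbrev mkLevel {l o i : S.ι} (hl : l ≤ o) (hi : o ≤ i) : S.Level o :=
  ⟨(OrderDual.toDual l, i), hl, hi⟩

/-- The first member `l` of the level `(l, i)`. -/
abbrev Level.lo {o : S.ι} (p : S.Level o) : S.ι := OrderDual.ofDual p.1.1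

/-- The second member `i` of the level `(l, i)`. -/
abbrev Level.hi {o : S.ι} (p : S.Level o) : S.ι := p.1.2

theorem Level.lo_le {o : S.ι} (p : S.Level o) : p.lo ≤ o := p.2.1

theorem Level.le_hi {o : S.ι} (p : S.Level o) : o ≤ p.hi := p.2.2

theorem Level.lo_anti {o : S.ι} {p q : S.Level o} (h : p ≤ q) : q.lo ≤ p.lo := h.1

theorem Level.hi_mono {o : S.ι} {p q : S.Level o} (h : p ≤ q) : p.hi ≤ q.hi := h.2

/-- The map `𝓓'(F i / F l) ⊗ μ(F l / F l') → 𝓓'(F i' / F l')`, `l' ≤ l ≤ i ≤ i'`, composed of the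
inverse image along `F i / F l' → F i / F l` and the direct image along
`F i / F l' → F i' / F l'`. -/
def trans {l' l i i' : S.ι} (hl : l' ≤ l) (hli : l ≤ i) (hi : i ≤ i') :
    Meas (S.obj hl) →ₗ[ℂ] Distr (S.obj hli) →ₗ[ℂ] Distr (S.obj ((hl.trans hli).trans hi)) :=
  LinearMap.mk₂ ℂ (fun c G => G ∘ₗ (S.adm hl hli).push c ∘ₗ (S.adm (hl.trans hli) hi).res)
    (fun c c' G => LinearMap.ext fun _ => map_add G ((S.adm hl hli).push c _)
      ((S.adm hl hli).push c' _))
    (fun t c G => LinearMap.ext fun _ => map_smul G t ((S.adm hl hli).push c _))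
    (fun _ _ _ => rfl) (fun _ _ _ => rfl)

theorem trans_apply {l' l i i' : S.ι} (hl : l' ≤ l) (hli : l ≤ i) (hi : i ≤ i')
    (c : Meas (S.obj hl)) (G : Distr (S.obj hli))
    (f : TestFun (S.obj ((hl.trans hli).trans hi))) :
    trans hl hli hi c G f =
      G ((S.adm hl hli).push c ((S.adm (hl.trans hli) hi).res f)) := rfl

theorem trans_trans {l'' l' l i i' i'' : S.ι} (hl' : l'' ≤ l') (hl : l' ≤ l) (hli : l ≤ i)
    (hi : i ≤ i') (hi' : i' ≤ i'') (c' : Meas (S.obj hl')) (c : Meas (S.obj hl))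
    (G : Distr (S.obj hli)) :
    trans hl' ((hl.trans hli).trans hi) hi' c' (trans hl hli hi c G) =
      trans (hl'.trans hl) hli (hi.trans hi') ((S.adm hl' hl).prod c' c) G := by
  refine LinearMap.ext fun f => ?_
  rw [trans_apply, trans_apply, trans_apply]
  rw [S.push_prod hl' hl hli]
  have h1 := S.push_res hl' (hl.trans hli) hi c'
    ((S.adm (hl'.trans ((hl.trans hli).trans hi)) hi').res f)
  rw [← h1]
  have h2 := S.res_res (hl'.trans (hl.trans hli)) hi hi' f
  rw [← h2]

variable (S) in
/-- The space `𝓓'(F i / F l) ⊗ μ(F o | F l) = Hom (μ(F o / F l), 𝓓'(F i / F l))` at the level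
`p = (l, i)`. -/
abbrev LevelDist (o : S.ι) (p : S.Level o) : Type _ :=
  Meas (S.obj p.lo_le) →ₗ[ℂ] Distr (S.obj (p.lo_le.trans p.le_hi))

variable [Finite K]

/-- The transition map `φ ↦ φ'`, `φ' (c ⊗ a) = (φ a) ⊗ c`, where
`μ(F o / F l') = μ(F l / F l') ⊗ μ(F o / F l)`. -/
def transition {o : S.ι} (p q : S.Level o) (h : p ≤ q) : S.LevelDist o p →ₗ[ℂ] S.LevelDist o q where
  toFun φ := (S.adm (Level.lo_anti h) p.lo_le).lift
    ((trans (Level.lo_anti h) (p.lo_le.trans p.le_hi) (Level.hi_mono h)).compl₂ φ)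
  map_add' φ φ' := C1Admissible.hom_ext (S.adm (Level.lo_anti h) p.lo_le) fun c a => by
    rw [LinearMap.add_apply, C1Admissible.lift_prod, C1Admissible.lift_prod,
      C1Admissible.lift_prod]
    rfl
  map_smul' t φ := C1Admissible.hom_ext (S.adm (Level.lo_anti h) p.lo_le) fun c a => by
    rw [LinearMap.smul_apply, C1Admissible.lift_prod, C1Admissible.lift_prod]
    change trans _ _ _ c (t • φ a) = _
    rw [map_smul]
    rfl

theorem transition_prod {o : S.ι} (p q : S.Level o) (h : p ≤ q) (φ : S.LevelDist o p)
    (c : Meas (S.obj (Level.lo_anti h))) (a : Meas (S.obj p.lo_le)) :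
    transition p q h φ ((S.adm (Level.lo_anti h) p.lo_le).prod c a) =
      trans (Level.lo_anti h) (p.lo_le.trans p.le_hi) (Level.hi_mono h) c (φ a) :=
  C1Admissible.lift_prod _ _ _ _

theorem transition_transition {o : S.ι} (p q r : S.Level o) (h : p ≤ q) (h' : q ≤ r)
    (φ : S.LevelDist o p) :
    transition q r h' (transition p q h φ) = transition p r (h.trans h') φ := by
  have hb : (S.adm (Level.lo_anti h') q.lo_le).prod (haar _)
      ((S.adm (Level.lo_anti h) p.lo_le).prod (haar _) (haar _)) ≠ 0 :=
    C1Admissible.prod_ne_zero _ (haar_ne_zero _)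
      (C1Admissible.prod_ne_zero _ (haar_ne_zero _) (haar_ne_zero _))
  refine Meas.hom_ext hb ?_
  rw [transition_prod, transition_prod, ← S.prod_assoc, trans_trans]
  exact (transition_prod p r (h.trans h') φ _ _).symm

variable (S) in
open scoped Classical in
/-- The space `𝓓'_{F(o)}(E)`. -/
def Dist (o : S.ι) : Type _ :=
  Module.DirectLimit (S.LevelDist o) (fun p q h => transition p q h)

open scoped Classical in
instance (o : S.ι) : AddCommGroup (S.Dist o) :=
  inferInstanceAs (AddCommGroup (Module.DirectLimit (S.LevelDist o) fun p q h => transition p q h))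

open scoped Classical in
instance (o : S.ι) : Module ℂ (S.Dist o) :=
  inferInstanceAs (Module ℂ (Module.DirectLimit (S.LevelDist o) fun p q h => transition p q h))

open scoped Classical in
/-- The canonical map from a level to the inductive limit. -/
def Dist.of {o : S.ι} (p : S.Level o) : S.LevelDist o p →ₗ[ℂ] S.Dist o :=
  Module.DirectLimit.of ℂ (S.Level o) (S.LevelDist o) (fun p q h => transition p q h) p

theorem Dist.of_transition {o : S.ι} {p q : S.Level o} (h : p ≤ q) (φ : S.LevelDist o p) :
    Dist.of q (transition p q h φ) = Dist.of p φ := by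
  classical exact Module.DirectLimit.of_f

open scoped Classical in
/-- The map out of the inductive limit given by a compatible family of maps. -/
def Dist.lift {o : S.ι} {M : Type*} [AddCommGroup M] [Module ℂ M]
    (g : ∀ p : S.Level o, S.LevelDist o p →ₗ[ℂ] M)
    (hg : ∀ p q h φ, g q (transition p q h φ) = g p φ) : S.Dist o →ₗ[ℂ] M :=
  Module.DirectLimit.lift ℂ (S.Level o) (S.LevelDist o) (fun p q h => transition p q h) g hg

theorem Dist.lift_of {o : S.ι} {M : Type*} [AddCommGroup M] [Module ℂ M]
    (g : ∀ p : S.Level o, S.LevelDist o p →ₗ[ℂ] M)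
    (hg : ∀ p q h φ, g q (transition p q h φ) = g p φ) (p : S.Level o) (φ : S.LevelDist o p) :
    Dist.lift g hg (Dist.of p φ) = g p φ := by
  classical exact Module.DirectLimit.lift_of _ _ _

/-! ### Virtual measures -/

variable (S) in
/-- The space `μ(F i | F j)` of virtual measures, the inductive limit over `l ≤ i, j` of the spaces
`Hom (μ(F i / F l), μ(F j / F l))`. All transition maps `f ↦ f'`, `f' (c ⊗ a) = c ⊗ f a`, are
isomorphisms and the index set is directed, so an element of the limit is the same as a compatible
family. -/
def VM (i j : S.ι) : Submodule ℂ
    (∀ l : {l : S.ι // l ≤ i ∧ l ≤ j}, Meas (S.obj l.2.1) →ₗ[ℂ] Meas (S.obj l.2.2)) where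
  carrier := {φ | ∀ (l' l : S.ι) (h : l' ≤ l) (hi : l ≤ i) (hj : l ≤ j) (c : Meas (S.obj h))
    (a : Meas (S.obj hi)), φ ⟨l', h.trans hi, h.trans hj⟩ ((S.adm h hi).prod c a) =
      (S.adm h hj).prod c (φ ⟨l, hi, hj⟩ a)}
  zero_mem' := fun _ _ h _ hj c _ => (map_zero ((S.adm h hj).prod c)).symm
  add_mem' := fun {_ _} hφ hφ' l' l h hi hj c a =>
    (congrArg₂ (· + ·) (hφ l' l h hi hj c a) (hφ' l' l h hi hj c a)).trans
      (map_add ((S.adm h hj).prod c) _ _).symm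
  smul_mem' := fun t {_} hφ l' l h hi hj c a =>
    (congrArg (t • ·) (hφ l' l h hi hj c a)).trans (map_smul ((S.adm h hj).prod c) t _).symm

/-- The map `μ(F i / F n) → μ(F j / F n)` which takes `x` to the `y` with `y ⊗ b = x ⊗ a`
in `μ(F l / F n)`. -/
def VM.quotAux {i j l n : S.ι} (hi : i ≤ l) (hj : j ≤ l) (hn : n ≤ i) (hn' : n ≤ j)
    (a : Meas (S.obj hi)) (b : Meas (S.obj hj)) : Meas (S.obj hn) →ₗ[ℂ] Meas (S.obj hn') :=
  (S.adm hn' hj).divRight b ∘ₗ (S.adm hn hi).prod.flip a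

theorem VM.quotAux_spec {i j l n : S.ι} (hi : i ≤ l) (hj : j ≤ l) (hn : n ≤ i) (hn' : n ≤ j)
    (a : Meas (S.obj hi)) (b : Meas (S.obj hj)) (hb : b ≠ 0) (x : Meas (S.obj hn)) :
    (S.adm hn' hj).prod (VM.quotAux hi hj hn hn' a b x) b = (S.adm hn hi).prod x a :=
  C1Admissible.prod_divRight _ hb _

theorem VM.quotAux_prod {i j l n n' : S.ι} (hi : i ≤ l) (hj : j ≤ l)
    (a : Meas (S.obj hi)) (b : Meas (S.obj hj)) (hb : b ≠ 0) (h : n' ≤ n) (hn : n ≤ i)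
    (hn' : n ≤ j) (c : Meas (S.obj h)) (x : Meas (S.obj hn)) :
    VM.quotAux hi hj (h.trans hn) (h.trans hn') a b ((S.adm h hn).prod c x) =
      (S.adm h hn').prod c (VM.quotAux hi hj hn hn' a b x) := by
  have h1 := S.prod_assoc h hn hi c x a
  have h2 := S.prod_assoc h hn' hj c (VM.quotAux hi hj hn hn' a b x) b
  rw [VM.quotAux_spec hi hj hn hn' a b hb] at h2
  have h3 := VM.quotAux_spec hi hj (h.trans hn) (h.trans hn') a b hb ((S.adm h hn).prod c x)
  rw [h1, ← h2] at h3
  have h4 := congrArg ((S.adm (h.trans hn') hj).divRight b) h3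
  rwa [C1Admissible.divRight_prod _ hb, C1Admissible.divRight_prod _ hb] at h4

/-- For `i, j ≤ l`, `a ∈ μ(F l / F i) = μ(F i | F l)` and a nonzero `b ∈ μ(F l / F j)`, with inverse
`b⁻¹ ∈ μ(F l | F j)`, the virtual measure `a ⊗ b⁻¹ ∈ μ(F i | F j)`. Its component
`μ(F i / F n) → μ(F j / F n)` takes `x` to the `y` with `y ⊗ b = x ⊗ a` in `μ(F l / F n)`. -/
def VM.quot {i j l : S.ι} {hi : i ≤ l} {hj : j ≤ l} (a : Meas (S.obj hi)) (b : Meas (S.obj hj))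
    (hb : b ≠ 0) : S.VM i j :=
  ⟨fun n => VM.quotAux hi hj n.2.1 n.2.2 a b, fun _ _ h hn hn' c x =>
    VM.quotAux_prod hi hj a b hb h hn hn' c x⟩

/-- The isomorphism `μ(F i | F j) = μ(F⁰ i | F⁰ j)`, that is,
`μ(F i | F l) ⊗ μ(F l | F j) = μ(F⁰ i | F⁰ l) ⊗ μ(F⁰ l | F⁰ j)` for a fixed `l ≤ i, j`, where
`μ(F i | F l) = μ(F i / F l)^* = μ(F⁰ l / F⁰ i) = μ(F⁰ i | F⁰ l)` and
`μ(F l | F j) = μ(F j / F l) = μ(F⁰ l / F⁰ j)^* = μ(F⁰ l | F⁰ j)`. Explicitly,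
`m ∈ μ(F i | F j)` is taken to `⟨m a, b⟩ • (a⁻¹ ⊗ b⁻¹)` for arbitrary nonzero `a ∈ μ(F i / F l)`,
`b ∈ μ(F⁰ l / F⁰ j)`, where `a⁻¹ ∈ μ(F⁰ l / F⁰ i)`. -/
def VM.dual {i j : S.ι} (m : S.VM i j) :
    S.dual.VM (op i) (op j) :=
  let l := (S.below i j).choose
  have hi : l ≤ i := (S.below i j).choose_spec.1
  have hj : l ≤ j := (S.below i j).choose_spec.2
  pair (m.1 ⟨l, hi, hj⟩ (haar (S.obj hi))) (haar (S.obj hj).dual) •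
    VM.quot (S := S.dual) (hi := op_le hi) (hj := op_le hj) (haarInv (S.obj hi))
      (haar (S.obj hj).dual) (haar_ne_zero _)

end C1System

/-! ### The two-dimensional Fourier transform -/

namespace C1System

section Fourier

variable {S : C1System.{k, u, v, w} K}

theorem dual_prod_assoc {i j l m : S.ι} (hij : i ≤ j) (hjl : j ≤ l) (hlm : l ≤ m)
    (c : Meas (S.obj hlm).dual) (b : Meas (S.obj hjl).dual) (a : Meas (S.obj hij).dual) :
    (S.adm hij (hjl.trans hlm)).dual.prod ((S.adm hjl hlm).dual.prod c b) a =
      (S.adm (hij.trans hjl) hlm).dual.prod c ((S.adm hij hjl).dual.prod b a) :=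
  S.dual.prod_assoc (op_le hlm) (op_le hjl)
    (op_le hij) c b a

theorem dual_push_res {i j l m : S.ι} (hij : i ≤ j) (hjl : j ≤ l) (hlm : l ≤ m)
    (c : Meas (S.obj hlm).dual) (f : TestFun (S.obj ((hij.trans hjl).trans hlm)).dual) :
    (S.adm hjl hlm).dual.push c ((S.adm hij (hjl.trans hlm)).dual.res f) =
      (S.adm hij hjl).dual.res ((S.adm (hij.trans hjl) hlm).dual.push c f) :=
  S.dual.push_res (op_le hlm) (op_le hjl)
    (op_le hij) c f

/-- The level of the dual system which corresponds to the level `(l, i)`, that is `(i, l)`. -/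
def Level.dual {o : S.ι} (p : S.Level o) : S.dual.Level (op o) :=
  ⟨(OrderDual.toDual (op p.hi), op p.lo), op_le p.le_hi, op_le p.lo_le⟩

theorem Level.dual_mono {o : S.ι} {p q : S.Level o} (h : p ≤ q) : p.dual ≤ q.dual :=
  ⟨Level.hi_mono h, Level.lo_anti h⟩

variable [Finite K] {ψ : AddChar K ℂ} (hψ : ψ ≠ 1)

/-- The map
`𝐅 ⊗ μ(F o | F i) : 𝓓'(F i / F l) ⊗ μ(F o | F l) → 𝓓'(F⁰ l / F⁰ i) ⊗ μ(F⁰ o | F⁰ i)`,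
`l ≤ o ≤ i`. An element `φ` of the first space, viewed as a linear map on `μ(F o / F l)`, is taken
to the linear map `x ↦ 𝐅_{x ⊗ a⁻¹} (φ a)` on `μ(F⁰ o / F⁰ i)`, for arbitrary nonzero
`a ∈ μ(F o / F l)` with inverse `a⁻¹ ∈ μ(F⁰ l / F⁰ o)`. -/
def fourierAux {l o i : S.ι} (hl : l ≤ o) (hi : o ≤ i) :
    (Meas (S.obj hl) →ₗ[ℂ] Distr (S.obj (hl.trans hi))) →ₗ[ℂ]
      Meas (S.obj hi).dual →ₗ[ℂ] Distr (S.obj (hl.trans hi)).dual :=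
  LinearMap.mk₂ ℂ (fun φ x => fourierDistr hψ (S.obj (hl.trans hi))
      ((S.adm hl hi).dual.prod x (haarInv (S.obj hl))) (φ (haar (S.obj hl))))
    (fun _ _ _ => by rw [LinearMap.add_apply, map_add])
    (fun _ _ _ => by rw [LinearMap.smul_apply, map_smul])
    (fun _ _ _ => by rw [map_add, LinearMap.add_apply, map_add, LinearMap.add_apply])
    (fun _ _ _ => by rw [map_smul, LinearMap.smul_apply, map_smul, LinearMap.smul_apply])

theorem fourierAux_spec {l o i : S.ι} (hl : l ≤ o) (hi : o ≤ i)
    (φ : Meas (S.obj hl) →ₗ[ℂ] Distr (S.obj (hl.trans hi))) (x : Meas (S.obj hi).dual)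
    (a : Meas (S.obj hl)) (b : Meas (S.obj hl).dual) :
    fourierDistr hψ (S.obj (hl.trans hi)) ((S.adm hl hi).dual.prod x b) (φ a) =
      pair a b • fourierAux hψ hl hi φ x := by
  change _ = pair a b • fourierDistr hψ (S.obj (hl.trans hi))
    ((S.adm hl hi).dual.prod x (haarInv (S.obj hl))) (φ (haar (S.obj hl)))
  rw [Meas.eq_smul (haar_ne_zero _) a, Meas.eq_smul (haarInv_ne_zero _) b]
  simp only [map_smul, LinearMap.smul_apply, pair_smul_left, pair_smul_right, pair_haarInv,
    mul_one, smul_smul]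
  rw [mul_comm]

/-- The map `fourierAux` from the level `(l, i)` to the dual level `(i, l)`. -/
def fourierLevel {o : S.ι} (p : S.Level o) :
    S.LevelDist o p →ₗ[ℂ] S.dual.LevelDist (op o) p.dual :=
  fourierAux hψ p.lo_le p.le_hi

theorem fourierLevel_transition {o : S.ι} (p q : S.Level o) (h : p ≤ q) (φ : S.LevelDist o p) :
    fourierLevel hψ q (transition p q h φ) =
      transition p.dual q.dual (Level.dual_mono h) (fourierLevel hψ p φ) := by
  refine C1Admissible.hom_ext (S.dual.adm (Level.lo_anti (Level.dual_mono h)) p.dual.lo_le)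
    fun d x => ?_
  rw [transition_prod]
  change Meas (S.obj (Level.hi_mono h)).dual at d
  change Meas (S.obj p.le_hi).dual at x
  refine LinearMap.ext fun f => ?_
  change TestFun (S.obj (q.lo_le.trans q.le_hi)).dual at f
  have hl := Level.lo_anti h
  have hi := Level.hi_mono h
  let a := haar (S.obj p.lo_le)
  let b := haarInv (S.obj p.lo_le)
  let c := haar (S.obj hl)
  let e := haarInv (S.obj hl)
  have hab : pair ((S.adm hl p.lo_le).prod c a) ((S.adm hl p.lo_le).dual.prod b e) = 1 := by
    rw [C1Admissible.pair_prod hψ, pair_haarInv, pair_haarInv, mul_one]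
  have h1 := fourierAux_spec hψ q.lo_le q.le_hi (transition p q h φ)
    ((S.adm p.le_hi hi).dual.prod d x)
    ((S.adm hl p.lo_le).prod c a) ((S.adm hl p.lo_le).dual.prod b e)
  rw [hab, one_smul, transition_prod] at h1
  refine (LinearMap.congr_fun h1 f).symm.trans ?_
  change φ a ((S.adm hl (p.lo_le.trans p.le_hi)).push c
      ((S.adm (hl.trans (p.lo_le.trans p.le_hi)) hi).res
        (fourierTest hψ (S.obj (q.lo_le.trans q.le_hi))
        ((S.adm q.lo_le q.le_hi).dual.prod ((S.adm p.le_hi hi).dual.prod d x)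
        ((S.adm hl p.lo_le).dual.prod b e)) f))) =
    φ a (fourierTest hψ (S.obj (p.lo_le.trans p.le_hi)) ((S.adm p.lo_le p.le_hi).dual.prod x b)
      ((S.adm (p.lo_le.trans p.le_hi) hi).dual.push d
        ((S.adm hl ((p.lo_le.trans p.le_hi).trans hi)).dual.res f)))
  congr 1
  rw [dual_prod_assoc (hl.trans p.lo_le) p.le_hi hi, C1Admissible.res_fourierTest,
    ← dual_prod_assoc hl p.lo_le p.le_hi, C1Admissible.push_fourierTest, pair_haarInv, one_smul,
    dual_push_res]

/-- The two-dimensional Fourier transform `𝐅 : 𝓓'_{F(o)}(E) → 𝓓'_{F⁰(o)}(Ě)`. -/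
def fourier (o : S.ι) : S.Dist o →ₗ[ℂ] S.dual.Dist (op o) :=
  Dist.lift (fun p => Dist.of p.dual ∘ₗ fourierLevel hψ p) fun p q h φ => by
    rw [LinearMap.comp_apply, LinearMap.comp_apply, fourierLevel_transition, Dist.of_transition]

end Fourier

end C1System

/-! ### Admissible triples of systems, the direct image and the characteristic distribution -/

theorem mass_eq_ind {E : C1Space.{k, u, v} K} [Subsingleton E.V] (m : Meas E) (i : E.I) :
    mass m = m.1 (ind E i) :=
  congrArg m.1 (TestFun.ext' fun x => by
    rw [Subsingleton.elim x 0, ind_of_mem (zero_mem _), ind_of_mem (zero_mem _)])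

/-- On the zero space, an invariant measure `m` takes `f` to `m({0}) * f 0`. -/
theorem Meas.apply_of_subsingleton {E : C1Space.{k, u, v} K} [Subsingleton E.V] (m : Meas E)
    (f : TestFun E) : m.1 f = mass m * f.1 0 := by
  have : f = f.1 0 • ind E (Classical.arbitrary E.I) := TestFun.ext' fun x => by
    rw [Subsingleton.elim x 0]
    change _ = f.1 0 * _
    rw [ind_of_mem (zero_mem _), mul_one]
  conv_lhs => rw [this]
  rw [map_smul, smul_eq_mul, mul_comm]
  rfl

theorem C1Admissible.mass_prod {E₁ : C1Space.{k, u₁, v₁} K} {E₂ : C1Space.{k, u₂, v₂} K}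
    {E₃ : C1Space.{k, u₃, v₃} K} {α : E₁.V →ₗ[K] E₂.V} {β : E₂.V →ₗ[K] E₃.V}
    [Subsingleton E₁.V] [Subsingleton E₂.V] [Subsingleton E₃.V]
    (h : C1Admissible E₁ E₂ E₃ α β) (c : Meas E₁) (a : Meas E₃) :
    mass (h.prod c a) = mass c * mass a := by
  obtain ⟨ε, hε⟩ := h.sub
  obtain ⟨γ, hγ⟩ := h.quot
  rw [mass_eq_ind _ (Classical.arbitrary _), h.prod_ind c a (hε.eq _) (hγ.eq _), ← mass_eq_ind,
    ← mass_eq_ind]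

/-- `mass` as a linear map. For the zero space this is the identification `μ(0) = ℂ`. -/
def massₗ (E : C1Space.{k, u, v} K) : Meas E →ₗ[ℂ] ℂ where
  toFun := mass
  map_add' _ _ := rfl
  map_smul' _ _ := rfl

/-- `F s = {0}`. -/
def C1System.IsZeroAt (S : C1System.{k, u, v, w} K) (s : S.ι) : Prop :=
  ∀ (j : S.ι) (h : j ≤ s), Subsingleton (S.obj h).V

/-- `F t` is the whole space. -/
def C1System.IsTotalAt (S : C1System.{k, u, v, w} K) (t : S.ι) : Prop :=
  ∀ (i : S.ι) (h : t ≤ i), Subsingleton (S.obj h).V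

theorem C1Space.subsingleton_dual (E : C1Space.{k, u, v} K) [Subsingleton E.V] :
    Subsingleton E.dual.V :=
  ⟨fun f g => Subtype.ext (LinearMap.ext fun x => by
    rw [Subsingleton.elim x 0, map_zero, map_zero])⟩

theorem C1System.IsTotalAt.dual {S : C1System.{k, u, v, w} K} {t : S.ι} (h : S.IsTotalAt t) :
    S.dual.IsZeroAt (C1System.op t) := fun i hi =>
  have := h (OrderDual.ofDual i) hi
  C1Space.subsingleton_dual (S.obj (i := t) (j := OrderDual.ofDual i) hi)

/-- The families of subquotients of an admissible triple of `C₂`-spaces. -/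
structure SysTriple (S₁ : C1System.{k, u₁, v₁, w₁} K) (S₂ : C1System.{k, u₂, v₂, w₂} K)
    (S₃ : C1System.{k, u₃, v₃, w₃} K) where
  ε : S₂.ι → S₁.ι
  γ : S₂.ι → S₃.ι
  ε_mono : ∀ {i j}, i ≤ j → ε i ≤ ε j
  γ_mono : ∀ {i j}, i ≤ j → γ i ≤ γ j
  ε_cofinal : ∀ i, ∃ j₁ j₂, ε j₁ ≤ i ∧ i ≤ ε j₂
  γ_cofinal : ∀ i, ∃ j₁ j₂, γ j₁ ≤ i ∧ i ≤ γ j₂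
  α : ∀ {i j} (h : i ≤ j), (S₁.obj (ε_mono h)).V →ₗ[K] (S₂.obj h).V
  β : ∀ {i j} (h : i ≤ j), (S₂.obj h).V →ₗ[K] (S₃.obj (γ_mono h)).V
  adm : ∀ {i j} (h : i ≤ j),
    C1Admissible (S₁.obj (ε_mono h)) (S₂.obj h) (S₃.obj (γ_mono h)) (α h) (β h)
  α_inc : ∀ {i j l} (hij : i ≤ j) (hjl : j ≤ l) (x),
    α (hij.trans hjl) (S₁.inc (ε_mono hij) (ε_mono hjl) x) = S₂.inc hij hjl (α hij x)
  α_prj : ∀ {i j l} (hij : i ≤ j) (hjl : j ≤ l) (x),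
    α hjl (S₁.prj (ε_mono hij) (ε_mono hjl) x) = S₂.prj hij hjl (α (hij.trans hjl) x)
  β_inc : ∀ {i j l} (hij : i ≤ j) (hjl : j ≤ l) (x),
    β (hij.trans hjl) (S₂.inc hij hjl x) = S₃.inc (γ_mono hij) (γ_mono hjl) (β hij x)
  β_prj : ∀ {i j l} (hij : i ≤ j) (hjl : j ≤ l) (x),
    β hjl (S₂.prj hij hjl x) = S₃.prj (γ_mono hij) (γ_mono hjl) (β (hij.trans hjl) x)

namespace SysTriple

variable {S₁ : C1System.{k, u₁, v₁, w₁} K} {S₂ : C1System.{k, u₂, v₂, w₂} K}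
    {S₃ : C1System.{k, u₃, v₃, w₃} K}

/-- The dual triple, `0 → Ě₃ → Ě₂ → Ě₁ → 0`. -/
def dual (T : SysTriple S₁ S₂ S₃) : SysTriple S₃.dual S₂.dual S₁.dual where
  ε i := C1System.op (T.γ (OrderDual.ofDual i))
  γ i := C1System.op (T.ε (OrderDual.ofDual i))
  ε_mono h := T.γ_mono h
  γ_mono h := T.ε_mono h
  ε_cofinal i := (T.γ_cofinal (OrderDual.ofDual i)).elim fun j₁ h => h.elim fun j₂ h =>
    ⟨OrderDual.toDual j₂, OrderDual.toDual j₁, h.2, h.1⟩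
  γ_cofinal i := (T.ε_cofinal (OrderDual.ofDual i)).elim fun j₁ h => h.elim fun j₂ h =>
    ⟨OrderDual.toDual j₂, OrderDual.toDual j₁, h.2, h.1⟩
  α {i j} h := (T.adm (i := OrderDual.ofDual j) (j := OrderDual.ofDual i) h).dualPrj
  β {i j} h := (T.adm (i := OrderDual.ofDual j) (j := OrderDual.ofDual i) h).dualInc
  adm {i j} h := (T.adm (i := OrderDual.ofDual j) (j := OrderDual.ofDual i) h).dual
  α_inc {i j l} hij hjl f := Subtype.ext (LinearMap.ext fun x => congrArg f.1
    (T.β_prj (i := OrderDual.ofDual l) (j := OrderDual.ofDual j) (l := OrderDual.ofDual i)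
      hjl hij x).symm)
  α_prj {i j l} hij hjl f := Subtype.ext (LinearMap.ext fun x => congrArg f.1
    (T.β_inc (i := OrderDual.ofDual l) (j := OrderDual.ofDual j) (l := OrderDual.ofDual i)
      hjl hij x).symm)
  β_inc {i j l} hij hjl f := Subtype.ext (LinearMap.ext fun x => congrArg f.1
    (T.α_prj (i := OrderDual.ofDual l) (j := OrderDual.ofDual j) (l := OrderDual.ofDual i)
      hjl hij x).symm)
  β_prj {i j l} hij hjl f := Subtype.ext (LinearMap.ext fun x => congrArg f.1
    (T.α_inc (i := OrderDual.ofDual l) (j := OrderDual.ofDual j) (l := OrderDual.ofDual i)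
      hjl hij x).symm)

variable (T : SysTriple S₁ S₂ S₃)

/-- The level `(ε l, ε i)`. -/
def lev {o : S₂.ι} (p : S₂.Level o) : S₁.Level (T.ε o) :=
  ⟨(OrderDual.toDual (T.ε p.lo), T.ε p.hi), T.ε_mono p.lo_le, T.ε_mono p.le_hi⟩

theorem lev_mono {o : S₂.ι} {p q : S₂.Level o} (h : p ≤ q) : T.lev p ≤ T.lev q :=
  ⟨T.ε_mono (C1System.Level.lo_anti h), T.ε_mono (C1System.Level.hi_mono h)⟩

theorem fibre_push {i j l : S₂.ι} (hij : i ≤ j) (hjl : j ≤ l)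
    [Subsingleton (S₃.obj (T.γ_mono hij)).V]
    (c₁ : Meas (S₁.obj (T.ε_mono hij))) (c₃ : Meas (S₃.obj (T.γ_mono hij)))
    (g : TestFun (S₂.obj (hij.trans hjl))) (x : (S₂.obj (hij.trans hjl)).V) :
    (T.adm hjl).fibre (S₂.prj hij hjl x)
        ((S₂.adm hij hjl).push ((T.adm hij).prod c₁ c₃) g) =
      mass c₃ • (S₁.adm (T.ε_mono hij) (T.ε_mono hjl)).push c₁
        ((T.adm (hij.trans hjl)).fibre x g) := by
  refine (S₁.adm (T.ε_mono hij) (T.ε_mono hjl)).push_ext fun y => ?_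
  change ((S₂.adm hij hjl).push ((T.adm hij).prod c₁ c₃) g).1
    (S₂.prj hij hjl x + T.α hjl (S₁.prj (T.ε_mono hij) (T.ε_mono hjl) y)) =
    mass c₃ * ((S₁.adm (T.ε_mono hij) (T.ε_mono hjl)).push c₁ _).1 _
  rw [T.α_prj hij hjl, ← map_add, C1Admissible.push_apply, C1Admissible.push_apply,
    C1Admissible.prod_apply, Meas.apply_of_subsingleton, ← map_zero (T.β hij),
    C1Admissible.push_apply]
  congr 1
  refine congrArg c₁.1 (TestFun.ext' fun z => ?_)
  change g.1 (x + T.α _ y + S₂.inc hij hjl (0 + T.α hij z)) = g.1 (x + T.α _ (y + S₁.inc _ _ z))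
  rw [zero_add, ← T.α_inc hij hjl, map_add, add_assoc]

theorem res_push {i j l : S₂.ι} (hij : i ≤ j) (hjl : j ≤ l)
    [Subsingleton (S₃.obj (T.γ_mono hij)).V]
    (c₁ : Meas (S₁.obj (T.ε_mono hij))) (c₃ : Meas (S₃.obj (T.γ_mono hij)))
    (g : TestFun (S₂.obj (hij.trans hjl))) :
    (T.adm hjl).res ((S₂.adm hij hjl).push ((T.adm hij).prod c₁ c₃) g) =
      mass c₃ • (S₁.adm (T.ε_mono hij) (T.ε_mono hjl)).push c₁
        ((T.adm (hij.trans hjl)).res g) := by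
  have e : ∀ {i j : S₂.ι} (h : i ≤ j) (f : TestFun (S₂.obj h)),
      (T.adm h).fibre 0 f = (T.adm h).res f :=
    fun h f => TestFun.ext' fun y => congrArg f.1 (zero_add _)
  rw [← e, ← e, ← T.fibre_push, map_zero]

theorem res_inc {i j l : S₂.ι} (hij : i ≤ j) (hjl : j ≤ l)
    (g : TestFun (S₂.obj (hij.trans hjl))) :
    (T.adm hij).res ((S₂.adm hij hjl).res g) =
      (S₁.adm (T.ε_mono hij) (T.ε_mono hjl)).res ((T.adm (hij.trans hjl)).res g) :=
  TestFun.ext' fun x => congrArg g.1 (T.α_inc hij hjl x).symm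

theorem prod_interchange {i j l : S₂.ι} (hij : i ≤ j) (hjl : j ≤ l)
    [Subsingleton (S₃.obj (T.γ_mono hij)).V]
    (c₁ : Meas (S₁.obj (T.ε_mono hij))) (c₃ : Meas (S₃.obj (T.γ_mono hij)))
    (a₁ : Meas (S₁.obj (T.ε_mono hjl))) (a₃ : Meas (S₃.obj (T.γ_mono hjl))) :
    (S₂.adm hij hjl).prod ((T.adm hij).prod c₁ c₃) ((T.adm hjl).prod a₁ a₃) =
      (T.adm (hij.trans hjl)).prod ((S₁.adm (T.ε_mono hij) (T.ε_mono hjl)).prod c₁ a₁)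
        ((S₃.adm (T.γ_mono hij) (T.γ_mono hjl)).prod c₃ a₃) := by
  refine Subtype.ext (LinearMap.ext fun g => ?_)
  rw [C1Admissible.prod_apply, C1Admissible.prod_apply, C1Admissible.prod_apply,
    C1Admissible.prod_apply]
  refine congrArg a₃.1 ?_
  have hs : Function.Surjective (T.β hjl ∘ₗ S₂.prj hij hjl) :=
    (T.adm hjl).surj.comp (S₂.adm hij hjl).surj
  refine TestFun.ext' fun z => ?_
  obtain ⟨x, rfl⟩ := hs z
  rw [LinearMap.comp_apply, C1Admissible.push_apply, T.fibre_push, T.β_prj,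
    C1Admissible.push_apply, Meas.apply_of_subsingleton c₃, map_smul, smul_eq_mul,
    ← C1Admissible.prod_apply]
  congr 1
  rw [← C1Admissible.push_apply]
  change _ = ((T.adm (hij.trans hjl)).push _ g).1
    (T.β _ x + S₃.inc (T.γ_mono hij) (T.γ_mono hjl) 0)
  rw [map_zero, add_zero]

theorem trans_comp_res {l' l i i' : S₂.ι} (hl : l' ≤ l) (h : l ≤ i) (hi : i ≤ i')
    [Subsingleton (S₃.obj (T.γ_mono hl)).V]
    (c₁ : Meas (S₁.obj (T.ε_mono hl))) (c₃ : Meas (S₃.obj (T.γ_mono hl)))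
    (G : Distr (S₁.obj (T.ε_mono h))) :
    C1System.trans hl h hi ((T.adm hl).prod c₁ c₃) (G ∘ₗ (T.adm h).res) =
      mass c₃ • (C1System.trans (T.ε_mono hl) (T.ε_mono h) (T.ε_mono hi) c₁ G ∘ₗ
        (T.adm ((hl.trans h).trans hi)).res) := by
  refine LinearMap.ext fun g => ?_
  change G ((T.adm h).res ((S₂.adm hl h).push _ ((S₂.adm (hl.trans h) hi).res g))) =
    mass c₃ * G ((S₁.adm (T.ε_mono hl) (T.ε_mono h)).push c₁
      ((S₁.adm (T.ε_mono (hl.trans h)) (T.ε_mono hi)).res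
        ((T.adm ((hl.trans h).trans hi)).res g)))
  rw [T.res_push, map_smul, T.res_inc, smul_eq_mul]

theorem exists_level {o : S₂.ι} (q : S₁.Level (T.ε o)) (s : S₃.ι) :
    ∃ p : S₂.Level o, q ≤ T.lev p ∧ T.γ p.lo ≤ s := by
  obtain ⟨j₁, -, h₁, -⟩ := T.ε_cofinal q.lo
  obtain ⟨-, j₂, -, h₂⟩ := T.ε_cofinal q.hi
  obtain ⟨j₃, -, h₃, -⟩ := T.γ_cofinal s
  obtain ⟨a, ha, ha'⟩ := S₂.below j₁ j₃
  obtain ⟨l, hl, hl'⟩ := S₂.below a o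
  obtain ⟨i, hi, hi'⟩ := S₂.above j₂ o
  exact ⟨C1System.mkLevel hl' hi', ⟨(T.ε_mono (hl.trans ha)).trans h₁, h₂.trans (T.ε_mono hi)⟩,
    (T.γ_mono (hl.trans ha')).trans h₃⟩

variable [Finite K]

/-- The direct image along `F₁ (ε i) / F₁ (ε l) → F₂ i / F₂ l`, tensored with a linear functional
`n` on `μ(F₃ (γ o) / F₃ (γ l))`: since `μ(F₂ o / F₂ l)` is the tensor product of
`μ(F₁ (ε o) / F₁ (ε l))` and `μ(F₃ (γ o) / F₃ (γ l))`, it takes `φ` to the map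
`a₁ ⊗ a₃ ↦ n a₃ • α_* (φ a₁)`. -/
def pushLevel {l o i : S₂.ι} (hl : l ≤ o) (hi : o ≤ i)
    (n : Meas (S₃.obj (T.γ_mono hl)) →ₗ[ℂ] ℂ) :
    (Meas (S₁.obj (T.ε_mono hl)) →ₗ[ℂ] Distr (S₁.obj (T.ε_mono (hl.trans hi)))) →ₗ[ℂ]
      Meas (S₂.obj hl) →ₗ[ℂ] Distr (S₂.obj (hl.trans hi)) :=
  (T.adm hl).lift ∘ₗ
    (LinearMap.smulRightₗ n ∘ₗ (T.adm (hl.trans hi)).res.dualMap).compRight ℂ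

theorem pushLevel_prod {l o i : S₂.ι} (hl : l ≤ o) (hi : o ≤ i)
    (n : Meas (S₃.obj (T.γ_mono hl)) →ₗ[ℂ] ℂ)
    (φ : Meas (S₁.obj (T.ε_mono hl)) →ₗ[ℂ] Distr (S₁.obj (T.ε_mono (hl.trans hi))))
    (a₁ : Meas (S₁.obj (T.ε_mono hl))) (a₃ : Meas (S₃.obj (T.γ_mono hl))) :
    T.pushLevel hl hi n φ ((T.adm hl).prod a₁ a₃) =
      n a₃ • (φ a₁ ∘ₗ (T.adm (hl.trans hi)).res) :=
  (T.adm hl).lift_prod _ _ _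

section

variable {o : S₂.ι} {s : S₃.ι} (ν : S₃.VM (T.γ o) s)

/-- The map `α_* ⊗ ν` at a level `p = (l, i)` with `F₃ (γ l) = {0}`. -/
def pushAt (p : S₂.Level o) (hp : T.γ p.lo ≤ s) :
    S₁.LevelDist (T.ε o) (T.lev p) →ₗ[ℂ] S₂.LevelDist o p :=
  T.pushLevel p.lo_le p.le_hi (massₗ _ ∘ₗ ν.1 ⟨T.γ p.lo, T.γ_mono p.lo_le, hp⟩)

theorem pushAt_transition (hs : S₃.IsZeroAt s) (p q : S₂.Level o) (h : p ≤ q)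
    (hp : T.γ p.lo ≤ s) (hq : T.γ q.lo ≤ s) (φ : S₁.LevelDist (T.ε o) (T.lev p)) :
    T.pushAt ν q hq (C1System.transition (T.lev p) (T.lev q) (T.lev_mono h) φ) =
      C1System.transition p q h (T.pushAt ν p hp φ) := by
  have hl := C1System.Level.lo_anti h
  have hi := C1System.Level.hi_mono h
  have i₁ : Subsingleton (S₃.obj hp).V := hs _ hp
  have i₂ : Subsingleton (S₃.obj ((T.γ_mono hl).trans hp)).V := hs _ _
  have i₃ : Subsingleton (S₃.obj (T.γ_mono hl)).V := (S₃.adm (T.γ_mono hl) hp).inj.subsingleton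
  have hb : (S₂.adm hl p.lo_le).prod ((T.adm hl).prod (haar _) (haar _))
      ((T.adm p.lo_le).prod (haar _) (haar _)) ≠ 0 :=
    C1Admissible.prod_ne_zero _ (C1Admissible.prod_ne_zero _ (haar_ne_zero _) (haar_ne_zero _))
      (C1Admissible.prod_ne_zero _ (haar_ne_zero _) (haar_ne_zero _))
  refine Meas.hom_ext hb ?_
  rw [C1System.transition_prod, T.prod_interchange]
  refine (T.pushLevel_prod q.lo_le q.le_hi _ _ _ _).trans ?_
  have h1 := T.pushLevel_prod p.lo_le p.le_hi
    (massₗ _ ∘ₗ ν.1 ⟨T.γ p.lo, T.γ_mono p.lo_le, hp⟩) φ (haar _) (haar _)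
  refine Eq.trans ?_ (congrArg (C1System.trans hl (p.lo_le.trans p.le_hi) hi
    ((T.adm hl).prod (haar _) (haar _))) h1).symm
  have h2 := ν.2 (T.γ q.lo) (T.γ p.lo) (T.γ_mono hl) (T.γ_mono p.lo_le) hp (haar _) (haar _)
  have h3 := C1System.transition_prod (T.lev p) (T.lev q) (T.lev_mono h) φ (haar _) (haar _)
  have h4 : mass ((S₃.adm (T.γ_mono hl) hp).prod (haar (S₃.obj (T.γ_mono hl)))
      (ν.1 ⟨T.γ p.lo, T.γ_mono p.lo_le, hp⟩ (haar (S₃.obj (T.γ_mono p.lo_le))))) =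
      mass (ν.1 ⟨T.γ p.lo, T.γ_mono p.lo_le, hp⟩ (haar (S₃.obj (T.γ_mono p.lo_le)))) *
        mass (haar (S₃.obj (T.γ_mono hl))) :=
    (C1Admissible.mass_prod _ _ _).trans (mul_comm _ _)
  have h5 := T.trans_comp_res hl (p.lo_le.trans p.le_hi) hi (haar _) (haar _) (φ (haar _))
  refine (congrArg₂ (· • ·) ((congrArg mass h2).trans h4)
    (congrArg (fun G => G ∘ₗ (T.adm (q.lo_le.trans q.le_hi)).res) h3)).trans ?_
  exact (mul_smul _ _ _).trans ((congrArg _ h5.symm).trans (map_smul _ _ _).symm)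

theorem of_pushAt_congr (hs : S₃.IsZeroAt s) (q : S₁.Level (T.ε o))
    (φ : S₁.LevelDist (T.ε o) q) (p p' : S₂.Level o) (h : q ≤ T.lev p) (h' : q ≤ T.lev p')
    (hp : T.γ p.lo ≤ s) (hp' : T.γ p'.lo ≤ s) :
    C1System.Dist.of p (T.pushAt ν p hp (C1System.transition q (T.lev p) h φ)) =
      C1System.Dist.of p' (T.pushAt ν p' hp' (C1System.transition q (T.lev p') h' φ)) := by
  obtain ⟨l, hl, hl'⟩ := S₂.below p.lo p'.lo
  obtain ⟨i, hi, hi'⟩ := S₂.above p.hi p'.hi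
  let r : S₂.Level o := C1System.mkLevel (hl.trans p.lo_le) (p.le_hi.trans hi)
  have h₁ : p ≤ r := ⟨hl, hi⟩
  have h₂ : p' ≤ r := ⟨hl', hi'⟩
  rw [← C1System.Dist.of_transition h₁, ← C1System.Dist.of_transition h₂,
    ← T.pushAt_transition ν hs p r h₁ hp ((T.γ_mono hl).trans hp),
    ← T.pushAt_transition ν hs p' r h₂ hp' ((T.γ_mono hl).trans hp),
    C1System.transition_transition, C1System.transition_transition]

/-- The direct image `α_* : 𝓓'_{F₁(ε(o))}(E₁) ⊗ μ(F₃(γ(o)) | {0}) → 𝓓'_{F₂(o)}(E₂)` (applied to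
`- ⊗ ν`), where `{0} = F₃ s`. -/
def alphaStar (hs : S₃.IsZeroAt s) : S₁.Dist (T.ε o) →ₗ[ℂ] S₂.Dist o :=
  C1System.Dist.lift (fun q => C1System.Dist.of (T.exists_level q s).choose ∘ₗ
      T.pushAt ν (T.exists_level q s).choose (T.exists_level q s).choose_spec.2 ∘ₗ
        C1System.transition q _ (T.exists_level q s).choose_spec.1)
    fun q q' h φ => by
      simp only [LinearMap.comp_apply]
      rw [C1System.transition_transition]
      exact T.of_pushAt_congr ν hs q φ _ _ _ _ _ _

theorem alphaStar_of (hs : S₃.IsZeroAt s) (q : S₁.Level (T.ε o)) (p : S₂.Level o)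
    (h : q ≤ T.lev p) (hp : T.γ p.lo ≤ s) (φ : S₁.LevelDist (T.ε o) q) :
    T.alphaStar ν hs (C1System.Dist.of q φ) =
      C1System.Dist.of p (T.pushAt ν p hp (C1System.transition q (T.lev p) h φ)) := by
  rw [alphaStar, C1System.Dist.lift_of]
  exact T.of_pushAt_congr ν hs q φ _ p _ h (T.exists_level q s).choose_spec.2 hp

end

end SysTriple

/-- The distribution `1_m ∈ 𝓓'_{F(o)}(E)`, where `m ∈ μ(F o | F t)` and `F t` is the whole space: it
is given at the level `(o, t)` by `m ∈ μ(F t / F o) ⊆ 𝓓'(F t / F o)` and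
`1 ∈ μ(F o | F o) = ℂ`. -/
def C1System.oneDist {S : C1System.{k, u, v, w} K} [Finite K] {o t : S.ι} (h : o ≤ t)
    (m : S.VM o t) : S.Dist o :=
  C1System.Dist.of (C1System.mkLevel le_rfl h) ((Meas (S.obj h)).subtype ∘ₗ m.1 ⟨o, le_rfl, h⟩)

/-- The characteristic distribution `δ_{E₁, μ ⊗ ν} = α_* (1_μ ⊗ ν) ∈ 𝓓'_{F₂(o)}(E₂)`, where
`F₁ t = V₁` and `F₃ s = {0}`. (The value does not use that `F₁ t` is the whole space.) -/
def SysTriple.charDist {S₁ : C1System.{k, u₁, v₁, w₁} K} {S₂ : C1System.{k, u₂, v₂, w₂} K}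
    {S₃ : C1System.{k, u₃, v₃, w₃} K} [Finite K] (T : SysTriple S₁ S₂ S₃) {o : S₂.ι} {t : S₁.ι}
    {s : S₃.ι} (ht : T.ε o ≤ t) (hs : S₃.IsZeroAt s) (μ : S₁.VM (T.ε o) t)
    (ν : S₃.VM (T.γ o) s) : S₂.Dist o :=
  T.alphaStar ν hs (C1System.oneDist ht μ)

/-! ### `C₂`-spaces -/

section Subquot

variable {V : Type u₁} {W : Type u₂} [AddCommGroup V] [Module K V] [AddCommGroup W]
  [Module K W]

/-- The map `B / A → B' / A'` induced by `f` with `f A ⊆ A'`, `f B ⊆ B'`. -/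
def subquotMap (f : V →ₗ[K] W) {A B : Submodule K V} {A' B' : Submodule K W}
    (hA : A ≤ A'.comap f) (hB : B ≤ B'.comap f) :
    (B ⧸ A.submoduleOf B) →ₗ[K] (B' ⧸ A'.submoduleOf B') :=
  Submodule.mapQ _ _ (f.restrict hB) fun x hx => hA (x := x.1) hx

end Subquot

/-- The structure of a `C₂`-space on the vector space `V`: a filtration together with `C₁`-spaces
`E_{i,j}` on `F j / F i`, `i ≤ j`, such that the triples `0 → E_{i,j} → E_{i,l} → E_{j,l} → 0` are
admissible. -/
structure C2Structure (K : Type k) [Field K] (V : Type u) [AddCommGroup V] [Module K V]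
    extends FilteredSpace.{k, u, v} K V where
  sub : ∀ {i j : I}, i ≤ j → C1Structure.{k, u, w} K (F j ⧸ (F i).submoduleOf (F j))
  adm : ∀ {i j l : I} (hij : i ≤ j) (hjl : j ≤ l),
    C1Admissible (sub hij).toSpace (sub (hij.trans hjl)).toSpace (sub hjl).toSpace
      (subquotMap LinearMap.id le_rfl (mono hjl)) (subquotMap LinearMap.id (mono hij) le_rfl)

/-- Complete `C₂`-spaces: all the `C₁`-spaces `E_{i,j}` are complete, and `V` is the inductive
limit over `i` of the projective limits of `F i / F j`, `j ≤ i`. -/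
structure C2Structure.IsComplete {V : Type u} [AddCommGroup V] [Module K V]
    (E : C2Structure.{k, u, v, w} K V) : Prop where
  sub : ∀ {i j : E.I} (h : i ≤ j), (E.sub h).toFilteredSpace.IsComplete
  limit : E.toFilteredSpace.IsComplete

/-- The family of subquotients of a `C₂`-space. -/
def C2Structure.sys {V : Type u} [AddCommGroup V] [Module K V] (E : C2Structure.{k, u, v, w} K V) :
    C1System.{k, u, v, w} K where
  ι := E.I
  below := E.below
  above := E.above
  obj h := (E.sub h).toSpace
  inc _ hjl := subquotMap LinearMap.id le_rfl (E.mono hjl)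
  prj hij _ := subquotMap LinearMap.id (E.mono hij) le_rfl
  adm := E.adm
  inc_inc _ _ _ x := by
    obtain ⟨x, rfl⟩ := Submodule.mkQ_surjective _ x
    rfl
  prj_prj _ _ _ x := by
    obtain ⟨x, rfl⟩ := Submodule.mkQ_surjective _ x
    rfl
  prj_inc _ _ _ x := by
    obtain ⟨x, rfl⟩ := Submodule.mkQ_surjective _ x
    rfl

theorem C2Structure.isTotalAt {V : Type u} [AddCommGroup V] [Module K V]
    {E : C2Structure.{k, u, v, w} K V} {t : E.I} (h : E.F t = ⊤) : E.sys.IsTotalAt t := by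
  intro i hi
  refine Submodule.Quotient.subsingleton_iff.2 ?_
  rw [Submodule.eq_top_iff']
  intro x
  change x.1 ∈ E.F t
  rw [h]
  trivial

theorem C2Structure.isZeroAt {V : Type u} [AddCommGroup V] [Module K V]
    {E : C2Structure.{k, u, v, w} K V} {s : E.I} (h : E.F s = ⊥) : E.sys.IsZeroAt s := by
  intro j hj
  refine Submodule.Quotient.subsingleton_iff.2 ?_
  rw [Submodule.eq_top_iff']
  intro x
  change x.1 ∈ E.F j
  have hx : x.1 = 0 := (Submodule.mem_bot K).1 (h.le x.2)
  rw [hx]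
  exact zero_mem _

/-- `0 → E₁ → E₂ → E₃ → 0`, with the maps `α` and `β`, is an admissible triple of `C₂`-spaces, with
the functions `ε` and `γ` through which the filtrations of `E₁` and `E₃` dominate those induced
from `E₂`. -/
structure C2Triple {V₁ : Type u₁} {V₂ : Type u₂} {V₃ : Type u₃} [AddCommGroup V₁] [Module K V₁]
    [AddCommGroup V₂] [Module K V₂] [AddCommGroup V₃] [Module K V₃]
    (E₁ : C2Structure.{k, u₁, v₁, w₁} K V₁) (E₂ : C2Structure.{k, u₂, v₂, w₂} K V₂)
    (E₃ : C2Structure.{k, u₃, v₃, w₃} K V₃) (α : V₁ →ₗ[K] V₂) (β : V₂ →ₗ[K] V₃) where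
  inj : Function.Injective α
  exact : Function.Exact α β
  surj : Function.Surjective β
  ε : E₂.I → E₁.I
  dom₁ : DominatesVia E₁.F (fun i => (E₂.F i).comap α) ε
  γ : E₂.I → E₃.I
  dom₃ : DominatesVia E₃.F (fun i => (E₂.F i).map β) γ
  adm : ∀ {i j : E₂.I} (h : i ≤ j),
    C1Admissible (E₁.sub (dom₁.mono h)).toSpace (E₂.sub h).toSpace (E₃.sub (dom₃.mono h)).toSpace
      (subquotMap α (dom₁.eq i).le (dom₁.eq j).le)
      (subquotMap β (Submodule.map_le_iff_le_comap.1 (dom₃.eq i).ge)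
        (Submodule.map_le_iff_le_comap.1 (dom₃.eq j).ge))

/-- The families of subquotients of an admissible triple. -/
def C2Triple.sys {V₁ : Type u₁} {V₂ : Type u₂} {V₃ : Type u₃} [AddCommGroup V₁] [Module K V₁]
    [AddCommGroup V₂] [Module K V₂] [AddCommGroup V₃] [Module K V₃]
    {E₁ : C2Structure.{k, u₁, v₁, w₁} K V₁} {E₂ : C2Structure.{k, u₂, v₂, w₂} K V₂}
    {E₃ : C2Structure.{k, u₃, v₃, w₃} K V₃} {α : V₁ →ₗ[K] V₂} {β : V₂ →ₗ[K] V₃}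
    (T : C2Triple E₁ E₂ E₃ α β) : SysTriple E₁.sys E₂.sys E₃.sys where
  ε := T.ε
  γ := T.γ
  ε_mono h := T.dom₁.mono h
  γ_mono h := T.dom₃.mono h
  ε_cofinal := T.dom₁.cofinal
  γ_cofinal := T.dom₃.cofinal
  α {i j} _ := subquotMap α (T.dom₁.eq i).le (T.dom₁.eq j).le
  β {i j} _ := subquotMap β (Submodule.map_le_iff_le_comap.1 (T.dom₃.eq i).ge)
    (Submodule.map_le_iff_le_comap.1 (T.dom₃.eq j).ge)
  adm h := T.adm h
  α_inc _ _ x := by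
    obtain ⟨x, rfl⟩ := Submodule.mkQ_surjective _ x
    rfl
  α_prj _ _ x := by
    obtain ⟨x, rfl⟩ := Submodule.mkQ_surjective _ x
    rfl
  β_inc _ _ x := by
    obtain ⟨x, rfl⟩ := Submodule.mkQ_surjective _ x
    rfl
  β_prj _ _ x := by
    obtain ⟨x, rfl⟩ := Submodule.mkQ_surjective _ x
    rfl

end HarmonicC2

end

open HarmonicC2

/-! Both sides can be compared at a single level. Take `l ≤ o ≤ i` with `γ l ≤ s` and `t ≤ ε i`, so
that F₃(γ l) = 0 and F₁(ε i) = V₁. The triple of subquotients is then 0 → V₁/F₁(ε l) → F₂(i)/F₂(l) →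
F₃(γ i) → 0, and the characteristic distribution is represented there by integration over the
subspace V₁/F₁(ε l) (`SysTriple.charDist_eq_of`). The two conditions on `(l, i)` are exchanged by
duality, so the dual level `(i, l)` represents the characteristic distribution of the dual triple in
the same way. As the two-dimensional transform is computed level by level, no limit argument
remains.

At this level the theorem is the Poisson formula for an admissible triple 0 → A → B → C → 0 of
C₁-spaces: if c is a measure on A, and d ⊗ n is a measure on B̌ with d on Č and n on Ǎ, then ∫_A
𝐅_{d⊗n} f dc = ⟨c, n⟩ ∫_Č f dd. Indeed, the restriction to A of the transform of f is the transform
of the fibre integral of f over Č (`C1Admissible.res_fourierTest`). The integral over A of a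
transform is ⟨c, n⟩ times the value at 0 of the transformed function (`inversion`), and the fibre
over 0 is Č itself.

The work lies in matching the measures.

(1) The transform at the level uses the measure (b₃ ⊗ b₁) ⊗ (b₃' ⊗ b₁'), first split along the
filtration and then along the triple, while the Poisson formula needs the splitting (b₃ ⊗ b₃') ⊗ (b₁
⊗ b₁') along the triple first. The two agree by the interchange law `SysTriple.prod_prod_prod_comm`,
which is Fubini's theorem for two middle integrations.

(2) The components of μ and ν at `l` have to be compared with the components of their duals at `i`,
whereas the identification of virtual measures is defined through one arbitrarily chosen lower
index. The relation `VM.DualRel` expresses the identification without a choice. It passes down and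
up along the lower index, hence holds at every lower index (`VM.dualRel_dual`).

(3) F₁(ε i)/V₁ and F₃(γ l) vanish, so measures on them and on their duals are numbers. With (2),
this turns the constants of the Poisson formula into those of the dual distribution
(`C1Admissible.mass_mul_apply_res_fourierTest`). -/

namespace HarmonicC2

variable {K : Type k} [Field K] [Finite K]

/-! ### Iterated integrals and the interchange law for products of measures -/

/-- Fubini's theorem for a function of two variables whose slices in the first variable have a
common support and a common period. -/
theorem Meas.fubini {E : C1Space.{k, u, v} K} {E' : C1Space.{k, u₁, v₁} K} (m : Meas E)
    (m' : Meas E') (g : E.V → TestFun E') (h : E'.V → TestFun E)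
    (hgh : ∀ y z, (g y).1 z = (h z).1 y) {i j : E.I}
    (hj : ∀ z y, y ∉ E.F j → (h z).1 y = 0)
    (hi : ∀ z, ∀ x ∈ E.F i, ∀ y, (h z).1 (y + x) = (h z).1 y)
    (P : TestFun E) (Q : TestFun E') (hP : ∀ y, P.1 y = m'.1 (g y))
    (hQ : ∀ z, Q.1 z = m.1 (h z)) : m.1 P = m'.1 Q := by
  -- Shrinking the period to F n ⊆ F j makes F j / F n finite, so that integration against `m`
  -- becomes one finite sum, the same for all slices.
  obtain ⟨n, hn, hn'⟩ := E.str.below i j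
  have hi' : ∀ z, ∀ x ∈ E.F n, ∀ y, (h z).1 (y + x) = (h z).1 y :=
    fun z x hx => hi z x (E.str.mono hn hx)
  have hg : ∀ y, y ∉ E.F j → g y = 0 := fun y hy => TestFun.ext' fun z => by
    rw [hgh, hj z y hy]; rfl
  have hg' : ∀ x ∈ E.F n, ∀ y, g (y + x) = g y := fun x hx y => TestFun.ext' fun z => by
    rw [hgh, hgh, hi' z x hx]
  have := finite_subquot hn'
  have := Fintype.ofFinite (E.F j ⧸ (E.F n).submoduleOf (E.F j))
  rw [Meas.apply_eq hn' m P (fun y hy => by rw [hP, hg y hy, map_zero])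
    (fun x hx y => by rw [hP, hP, hg' x hx])]
  -- Here `Q` is a finite linear combination of the slices `g y`, as an identity of test functions.
  -- The interchange of the integrals is then the linearity of `m'`.
  have hQ' : Q = m.1 (ind E n) • ∑ q : E.F j ⧸ (E.F n).submoduleOf (E.F j),
      g (Quotient.out q : E.F j) := TestFun.ext' fun z => by
    rw [hQ, Meas.apply_eq hn' m (h z) (hj z) (hi' z), cosetSum, finsum_eq_sum_of_fintype,
      mul_comm, Finset.sum_congr rfl fun q _ => (hgh _ z).symm]
    change _ = m.1 (ind E n) * _
    rw [AddSubmonoidClass.coe_finsetSum, Finset.sum_apply]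
  rw [hQ', map_smul, map_sum, cosetSum, finsum_eq_sum_of_fintype,
    Finset.sum_congr rfl fun q _ => hP _, smul_eq_mul, mul_comm]

/-- Since μ(E₂) is a line, it is spanned by the nonzero product of `c` with a Haar measure. -/
theorem C1Admissible.exists_prod_left {E₁ : C1Space.{k, u₁, v₁} K} {E₂ : C1Space.{k, u₂, v₂} K}
    {E₃ : C1Space.{k, u₃, v₃} K} {α : E₁.V →ₗ[K] E₂.V} {β : E₂.V →ₗ[K] E₃.V}
    (h : C1Admissible E₁ E₂ E₃ α β) {c : Meas E₁} (hc : c ≠ 0) (z : Meas E₂) :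
    ∃ a, h.prod c a = z := by
  refine ⟨(mass z / mass (h.prod c (haar E₃))) • haar E₃, ?_⟩
  rw [map_smul]
  exact (Meas.eq_smul (h.prod_ne_zero hc (haar_ne_zero E₃)) z).symm

theorem C1Admissible.prod_right_injective {E₁ : C1Space.{k, u₁, v₁} K}
    {E₂ : C1Space.{k, u₂, v₂} K} {E₃ : C1Space.{k, u₃, v₃} K} {α : E₁.V →ₗ[K] E₂.V}
    {β : E₂.V →ₗ[K] E₃.V} (h : C1Admissible E₁ E₂ E₃ α β) {b : Meas E₃} (hb : b ≠ 0)
    {c c' : Meas E₁} (H : h.prod c b = h.prod c' b) : c = c' := by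
  rw [← h.divRight_prod hb c, H, h.divRight_prod hb]

namespace SysTriple

variable {S₁ : C1System.{k, u₁, v₁, w₁} K} {S₂ : C1System.{k, u₂, v₂, w₂} K}
    {S₃ : C1System.{k, u₃, v₃, w₃} K} (T : SysTriple S₁ S₂ S₃)

/-- Both sides integrate first over the piece of `S₁` between `i` and `j` and last over the piece of
`S₃` between `j` and `l`. In between come the integrals against `a₁` and `c₃`, in opposite orders,
so `Meas.fubini` applies to the function left by the first integration. Unlike in
`prod_interchange`, no piece has to vanish. -/
theorem prod_prod_prod_comm {i j l : S₂.ι} (hij : i ≤ j) (hjl : j ≤ l)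
    (c₁ : Meas (S₁.obj (T.ε_mono hij))) (c₃ : Meas (S₃.obj (T.γ_mono hij)))
    (a₁ : Meas (S₁.obj (T.ε_mono hjl))) (a₃ : Meas (S₃.obj (T.γ_mono hjl))) :
    (S₂.adm hij hjl).prod ((T.adm hij).prod c₁ c₃) ((T.adm hjl).prod a₁ a₃) =
      (T.adm (hij.trans hjl)).prod ((S₁.adm (T.ε_mono hij) (T.ε_mono hjl)).prod c₁ a₁)
        ((S₃.adm (T.γ_mono hij) (T.γ_mono hjl)).prod c₃ a₃) := by
  refine Subtype.ext (LinearMap.ext fun f => ?_)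
  rw [C1Admissible.prod_apply, C1Admissible.prod_apply, C1Admissible.prod_apply,
    C1Admissible.prod_apply]
  -- The outermost integral is the same on both sides. It is enough to compare the integrands at the
  -- image of an arbitrary `x`.
  refine congrArg a₃.1 ?_
  have hs : Function.Surjective (T.β hjl ∘ₗ S₂.prj hij hjl) :=
    (T.adm hjl).surj.comp (S₂.adm hij hjl).surj
  refine TestFun.ext' fun z => ?_
  obtain ⟨x, rfl⟩ := hs z
  rw [LinearMap.comp_apply, C1Admissible.push_apply, T.β_prj, C1Admissible.push_apply]
  have hs₁ := (S₁.adm (T.ε_mono hij) (T.ε_mono hjl)).surj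
  have hs₂ := (T.adm hij).surj
  obtain ⟨ε, hε⟩ := (T.adm hjl).sub
  obtain ⟨γ, hγ⟩ := (S₂.adm hij hjl).quot
  obtain ⟨γ', hγ'⟩ := (S₁.adm (T.ε_mono hij) (T.ε_mono hjl)).quot
  obtain ⟨ε', hε'⟩ := (T.adm (hij.trans hjl)).sub
  obtain ⟨⟨j₀, hj₀⟩, i₀, hi₀⟩ := f.2
  -- The member `j₁` contains both the support of `f` and the point `x`, hence the support of the
  -- translate of `f` by `x`.
  obtain ⟨n, hn⟩ := (S₂.obj (hij.trans hjl)).str.union x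
  obtain ⟨j₁, hj₁, hn₁⟩ := (S₂.obj (hij.trans hjl)).str.above j₀ n
  -- The function of two variables is the `c₁`-integral of `f` over the coset of x + y' + z', for
  -- lifts y' and z' of the two variables. Its support in `y` has to be bounded uniformly in `z`: F
  -- j₁ is projected to the quotient, which kills z', and then cut down to the piece of `S₁`.
  -- Dually, the period F i₀ is cut down to `S₁` and then projected.
  refine Meas.fubini a₁ c₃
    (fun y => (T.adm hij).push c₁ ((S₂.adm hij hjl).fibre
      (x + T.α (hij.trans hjl) (Function.surjInv hs₁ y)) f))
    (fun z => (S₁.adm (T.ε_mono hij) (T.ε_mono hjl)).push c₁ ((T.adm (hij.trans hjl)).fibre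
      (x + S₂.inc hij hjl (Function.surjInv hs₂ z)) f)) ?_ (i := γ' (ε' i₀)) (j := ε (γ j₁)) ?_ ?_
      _ _ ?_ ?_
  · intro y z
    -- The chosen lifts are named before `y` and `z` are rewritten as images of them, so that the
    -- rewriting does not enter the lifts.
    obtain ⟨y', hy'⟩ : ∃ y', Function.surjInv hs₁ y = y' := ⟨_, rfl⟩
    obtain ⟨z', hz'⟩ : ∃ z', Function.surjInv hs₂ z = z' := ⟨_, rfl⟩
    have hy : y = S₁.prj (T.ε_mono hij) (T.ε_mono hjl) y' := by
      rw [← hy', Function.surjInv_eq hs₁]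
    have hz : z = T.β hij z' := by rw [← hz', Function.surjInv_eq hs₂]
    simp only [hy', hz']
    rw [hy, hz, C1Admissible.push_apply, C1Admissible.push_apply]
    refine congrArg c₁.1 (TestFun.ext' fun t => ?_)
    change f.1 (x + T.α _ y' + S₂.inc hij hjl (z' + T.α hij t)) =
      f.1 (x + S₂.inc hij hjl z' + T.α _ (y' + S₁.inc _ _ t))
    refine congrArg f.1 ?_
    rw [map_add, map_add, T.α_inc hij hjl]
    abel
  · intro z y hy
    obtain ⟨y, rfl⟩ := hs₁ y
    rw [C1Admissible.push_apply]
    refine (congrArg c₁.1 (TestFun.ext' fun t => ?_)).trans (map_zero c₁.1)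
    refine hj₀ _ fun hm => hy ?_
    obtain ⟨z', hz'⟩ : ∃ z', Function.surjInv hs₂ z = z' := ⟨_, rfl⟩
    rw [hz'] at hm
    rw [hε.eq]
    change T.α hjl _ ∈ (S₂.obj hjl).F (γ j₁)
    rw [hγ.eq]
    refine ⟨_, sub_mem ((S₂.obj (hij.trans hjl)).str.mono hj₁ hm)
      ((S₂.obj (hij.trans hjl)).str.mono hn₁ hn), ?_⟩
    -- The contributions of z' and of the integration variable `t` come from the sub-piece and
    -- vanish in the quotient. What remains of the difference is the image of `y`.
    have h₁ : S₂.prj hij hjl (S₂.inc hij hjl z') = 0 :=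
      ((S₂.adm hij hjl).exact _).2 ⟨_, rfl⟩
    have h₂ : S₁.prj (T.ε_mono hij) (T.ε_mono hjl) (S₁.inc (T.ε_mono hij) (T.ε_mono hjl) t) = 0 :=
      ((S₁.adm (T.ε_mono hij) (T.ε_mono hjl)).exact _).2 ⟨_, rfl⟩
    rw [map_sub, map_add, map_add, h₁, ← T.α_prj, map_add, h₂, add_zero, add_zero,
      add_sub_cancel_left]
  · intro z x' hx' y
    rw [hγ'.eq] at hx'
    obtain ⟨x', hx', rfl⟩ := hx'
    obtain ⟨y, rfl⟩ := hs₁ y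
    rw [← map_add, C1Admissible.push_apply, C1Admissible.push_apply]
    refine congrArg c₁.1 (TestFun.ext' fun t => ?_)
    change x' ∈ (S₁.obj _).F (ε' i₀) at hx'
    rw [hε'.eq] at hx'
    refine Eq.trans (congrArg f.1 ?_) (hi₀ _ hx' _)
    rw [map_add, map_add, map_add]
    abel
  · intro y
    change ((S₂.adm hij hjl).push _ f).1 (S₂.prj hij hjl x + T.α hjl y) = _
    -- The point is written as the image of the very lift used in the slice, so that the two fibres
    -- coincide literally.
    conv_lhs => rw [← Function.surjInv_eq hs₁ y]
    rw [T.α_prj hij hjl, ← map_add, C1Admissible.push_apply, C1Admissible.prod_apply]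
  · intro z
    change ((T.adm (hij.trans hjl)).push _ f).1 (T.β _ x + S₃.inc _ _ z) = _
    conv_lhs => rw [← Function.surjInv_eq hs₂ z]
    rw [← T.β_inc hij hjl, ← map_add, C1Admissible.push_apply, C1Admissible.prod_apply]

end SysTriple

/-! ### The dual of a virtual measure -/

theorem Meas.exists_eq_smul {E : C1Space.{k, u, v} K} {b : Meas E} (hb : b ≠ 0) (m : Meas E) :
    ∃ r : ℂ, m = r • b := ⟨_, Meas.eq_smul hb m⟩

/-- Both sides are linear in each of `a`, `b'` and `e`, which run through lines. So only the case of
Haar measures and their inverses has to be checked, and there the identity is `hq`, because the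
inverse pairs to 1 with the Haar measure. -/
theorem C1Admissible.pair_smul_dual_prod_eq {E₁ : C1Space.{k, u₁, v₁} K}
    {E₁' : C1Space.{k, u₁, v₁} K} {E₂ : C1Space.{k, u₂, v₂} K} {E₃ : C1Space.{k, u₃, v₃} K}
    {E₃' : C1Space.{k, u₃, v₃} K} {α : E₁.V →ₗ[K] E₂.V} {β : E₂.V →ₗ[K] E₃.V}
    {α' : E₁'.V →ₗ[K] E₂.V} {β' : E₂.V →ₗ[K] E₃'.V} (h : C1Admissible E₁ E₂ E₃ α β)
    (h' : C1Admissible E₁' E₂ E₃' α' β') (L : Meas E₁ →ₗ[ℂ] Meas E₁') {q : Meas E₃'.dual}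
    {b : Meas E₃.dual} (hq : h'.dual.prod q (haar E₁'.dual) = h.dual.prod b (haarInv E₁))
    (a : Meas E₁) (b' : Meas E₁.dual) (e : Meas E₁'.dual) :
    pair (L a) e • h.dual.prod b b' =
      pair a b' • h'.dual.prod (pair (L (haar E₁)) (haar E₁'.dual) • q) e := by
  obtain ⟨r, rfl⟩ := Meas.exists_eq_smul (haar_ne_zero E₁) a
  obtain ⟨r', rfl⟩ := Meas.exists_eq_smul (haarInv_ne_zero E₁) b'
  obtain ⟨r'', rfl⟩ := Meas.exists_eq_smul (haar_ne_zero E₁'.dual) e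
  obtain ⟨x, hx⟩ : ∃ x, pair (L (haar E₁)) (haar E₁'.dual) = x := ⟨_, rfl⟩
  simp only [map_smul, LinearMap.smul_apply, pair_smul_left, pair_smul_right, pair_haarInv, hq,
    smul_smul, hx]
  congr 1
  ring

namespace C1System

variable {S : C1System.{k, u, v, w} K}

/-- Multiplicativity of the pairing and associativity of products. This describes the effect of
lowering the index from `n` to `n'` on either side of `VM.DualRel`: the side is multiplied by the
number `pair c d` and tensored with `d`. -/
theorem pair_prod_smul_dual_prod {ψ : AddChar K ℂ} (hψ : ψ ≠ 1) {n' n i j N : S.ι} (h : n' ≤ n)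
    (hi : n ≤ i) (hi' : i ≤ N) (hj : n ≤ j) (b : Meas (S.obj hi').dual) (b' : Meas (S.obj hi).dual)
    (c : Meas (S.obj h)) (d : Meas (S.obj h).dual) (x : Meas (S.obj hj)) (e : Meas (S.obj hj).dual) :
    pair ((S.adm h hj).prod c x) ((S.adm h hj).dual.prod e d) •
        (S.adm (h.trans hi) hi').dual.prod b ((S.adm h hi).dual.prod b' d) =
      pair c d • (S.adm h (hi.trans hi')).dual.prod
        (pair x e • (S.adm hi hi').dual.prod b b') d := by
  rw [C1Admissible.pair_prod hψ, ← dual_prod_assoc h hi hi', mul_smul, map_smul,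
    LinearMap.smul_apply]

/-- The relation between the component of `m ∈ μ(F i | F j)` at `n`, the measure
`b ∈ μ(F⁰ i / F⁰ N)` and its image `M ∈ μ(F⁰ j / F⁰ N)` under the dual of `m`. -/
def VM.DualRel {i j : S.ι} (m : S.VM i j) {N : S.ι} {hi' : i ≤ N} {hj' : j ≤ N}
    (b : Meas (S.obj hi').dual) (M : Meas (S.obj hj').dual) (n : S.ι) : Prop :=
  ∀ (hi : n ≤ i) (hj : n ≤ j) (a : Meas (S.obj hi)) (b' : Meas (S.obj hi).dual)
    (e : Meas (S.obj hj).dual),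
    pair (m.1 ⟨n, hi, hj⟩ a) e • (S.adm hi hi').dual.prod b b' =
      pair a b' • (S.adm hj hj').dual.prod M e

/-- The relation at `n'`, applied to products with Haar measures of F n / F n' and of its dual, is
the relation at `n` times a nonzero number and a nonzero measure, both of which cancel. -/
theorem VM.DualRel.of_le {ψ : AddChar K ℂ} (hψ : ψ ≠ 1) {i j : S.ι} {m : S.VM i j}
    {N : S.ι} {hi' : i ≤ N} {hj' : j ≤ N} {b : Meas (S.obj hi').dual} {M : Meas (S.obj hj').dual}
    {n' n : S.ι} (h : n' ≤ n) (H : VM.DualRel m b M n') : VM.DualRel m b M n := by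
  intro hi hj a b' e
  have hc := haar_ne_zero (S.obj h)
  have hd := haar_ne_zero (S.obj h).dual
  have h₁ := H (h.trans hi) (h.trans hj) ((S.adm h hi).prod (haar (S.obj h)) a)
    ((S.adm h hi).dual.prod b' (haar (S.obj h).dual)) ((S.adm h hj).dual.prod e (haar (S.obj h).dual))
  rw [m.2 n' n h hi hj, pair_prod_smul_dual_prod hψ h hi hi' hj,
    pair_prod_smul_dual_prod hψ h hj hj' hi] at h₁
  exact (S.adm h (hi.trans hi')).dual.prod_right_injective hd
    (smul_right_injective _ (pair_ne_zero hc hd) h₁)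

/-- Conversely, all measures at `n'` are products of measures at `n` with fixed Haar measures, as
the spaces of measures are lines. So the relation at `n` can be multiplied up. -/
theorem VM.DualRel.anti {ψ : AddChar K ℂ} (hψ : ψ ≠ 1) {i j : S.ι} {m : S.VM i j}
    {N : S.ι} {hi' : i ≤ N} {hj' : j ≤ N} {b : Meas (S.obj hi').dual} {M : Meas (S.obj hj').dual}
    {n' n : S.ι} (h : n' ≤ n) (hi : n ≤ i) (hj : n ≤ j) (H : VM.DualRel m b M n) :
    VM.DualRel m b M n' := by
  intro hin hjn a b' e
  have hd := haar_ne_zero (S.obj h).dual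
  obtain ⟨a, rfl⟩ := (S.adm h hi).exists_prod_left (haar_ne_zero (S.obj h)) a
  rw [← (S.adm h hi).dual.prod_divRight hd b', ← (S.adm h hj).dual.prod_divRight hd e,
    m.2 n' n h hi hj, pair_prod_smul_dual_prod hψ h hi hi' hj, H,
    pair_prod_smul_dual_prod hψ h hj hj' hi]

/-- The witness is the lower index chosen in the definition of `VM.dual`. There the relation unwinds
to the property that defines the quotient measure, `VM.quotAux_spec`. -/
theorem VM.exists_dualRel {i j : S.ι} (m : S.VM i j) {N : S.ι} (hi' : i ≤ N) (hj' : j ≤ N)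
    (b : Meas (S.obj hi').dual) :
    ∃ l : S.ι, l ≤ i ∧ l ≤ j ∧
      VM.DualRel m (hj' := hj') b ((VM.dual m).1 ⟨op N, op_le hi', op_le hj'⟩ b) l :=
  have hi := (S.below i j).choose_spec.1
  have hj := (S.below i j).choose_spec.2
  ⟨_, hi, hj, fun _ _ => (S.adm hi hi').pair_smul_dual_prod_eq (S.adm hj hj') (m.1 ⟨_, hi, hj⟩)
    (VM.quotAux_spec (S := S.dual) (op_le hi) (op_le hj) (op_le hi') (op_le hj')
      (haarInv (S.obj hi)) (haar (S.obj hj).dual) (haar_ne_zero _) b)⟩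

/-- The component at `N` of the dual of a virtual measure `m ∈ μ(F i | F j)`, in terms of the
component of `m` at `n`. -/
theorem VM.dualRel_dual {ψ : AddChar K ℂ} (hψ : ψ ≠ 1) {i j : S.ι} (m : S.VM i j) {N : S.ι}
    (hi' : i ≤ N) (hj' : j ≤ N) (b : Meas (S.obj hi').dual) (n : S.ι) :
    VM.DualRel m (hj' := hj') b ((VM.dual m).1 ⟨op N, op_le hi', op_le hj'⟩ b) n := by
  obtain ⟨l, hi, hj, h⟩ := VM.exists_dualRel m hi' hj' b
  -- The indices `l` and `n` need not be comparable: the relation is carried down from `l` to a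
  -- common lower bound and then up to `n`.
  obtain ⟨n', hl, hn⟩ := S.below l n
  exact (h.anti hψ hl hi hj).of_le hψ hn

end C1System

/-! ### The Poisson formula for a triple of C₁-spaces -/

omit [Finite K] in
theorem C1Admissible.push_zero {E₁ : C1Space.{k, u₁, v₁} K} {E₂ : C1Space.{k, u₂, v₂} K}
    {E₃ : C1Space.{k, u₃, v₃} K} {α : E₁.V →ₗ[K] E₂.V} {β : E₂.V →ₗ[K] E₃.V}
    (h : C1Admissible E₁ E₂ E₃ α β) (c : Meas E₁) (f : TestFun E₂) :
    (h.push c f).1 0 = c.1 (h.res f) := by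
  rw [← map_zero β, h.push_apply]
  exact congrArg c.1 (TestFun.ext' fun y => congrArg f.1 (zero_add _))

section

variable {ψ : AddChar K ℂ} (hψ : ψ ≠ 1)
  {E₁ : C1Space.{k, u₁, v₁} K} {E₂ : C1Space.{k, u₁, v₁} K} {E₃ : C1Space.{k, u₁, v₁} K}
  {α : E₁.V →ₗ[K] E₂.V} {β : E₂.V →ₗ[K] E₃.V} (h : C1Admissible E₁ E₂ E₃ α β)

/-- Here `E₁` is all of `E₂` up to the zero space `E₃`, so this is Fourier inversion at 0. The
hypothesis `H` supplies the constant: after cancelling `e` it relates `n` to `M`, and measures on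
the dual of the zero space are given by their masses. -/
theorem C1Admissible.apply_res_fourierTest [Subsingleton E₃.V] {m : Meas E₁} {n : Meas E₂.dual}
    {M : Meas E₃.dual} {e : Meas E₁.dual} (he : e ≠ 0) {r : ℂ}
    (H : pair m e • n = r • h.dual.prod M e) (g : TestFun E₂.dual) :
    m.1 (h.res (fourierTest hψ E₂ n g)) = r * (mass M * g.1 0) := by
  have := C1Space.subsingleton_dual E₃
  obtain ⟨n, rfl⟩ : ∃ n', h.dual.prod n' e = n := ⟨_, h.dual.prod_divRight he n⟩
  have H' : pair m e • n = r • M := h.dual.prod_right_injective he (by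
    rw [map_smul, map_smul, LinearMap.smul_apply, LinearMap.smul_apply, H])
  have H'' : pair m e * mass n = r * mass M := congrArg mass H'
  rw [h.res_fourierTest, inversion, h.dual.push_zero, Meas.apply_of_subsingleton, ← mul_assoc, H'',
    mul_assoc]
  exact congrArg (fun x => r * (mass M * g.1 x)) (map_zero _)

omit [Finite K] in
theorem pair_eq_mass_mul_mass {E : C1Space.{k, u, v} K} [Subsingleton E.V] (m : Meas E)
    (e : Meas E.dual) : pair m e = mass m * mass e := by
  have := C1Space.subsingleton_dual E
  rw [mass_eq_ind e (OrderDual.toDual (Classical.arbitrary E.I))]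
  rfl

/-- With `E₁` zero, restriction identifies test functions on the duals of `E₂` and `E₃`. The
relation `H` then compares `d` with `M` up to the masses on the zero space, and the mass of `e`
cancels. -/
theorem C1Admissible.mass_mul_apply [Subsingleton E₁.V] {x : Meas E₁} {d : Meas E₂.dual}
    {M : Meas E₃.dual} {e : Meas E₁.dual} (he : e ≠ 0) {r : ℂ}
    (H : pair x e • d = r • h.dual.prod M e) (g : TestFun E₂.dual) :
    mass x * d.1 g = r * M.1 (h.dual.res g) := by
  have := C1Space.subsingleton_dual E₁
  have H' : pair x e * d.1 g = r * (h.dual.prod M e).1 g :=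
    congrArg (fun m : Meas E₂.dual => m.1 g) H
  rw [h.dual.prod_apply, Meas.apply_of_subsingleton e, h.dual.push_zero,
    pair_eq_mass_mul_mass] at H'
  refine mul_left_cancel₀ (mass_ne_zero he) ?_
  linear_combination H'

/-- The Poisson formula for the middle triple `h`, with the normalisations moved to the dual side.
The triple `h₁` replaces F₁(ε i) by V₁ and `h₃` divides F₃(γ i) by the zero subspace. The hypotheses
`H₁` and `H₃` have the shape of `VM.DualRel`, and `r₁`, `r₃` stand for the pairings that occur
there. -/
theorem C1Admissible.mass_mul_apply_res_fourierTest {A₁ : C1Space.{k, u₁, v₁} K}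
    {E₁ : C1Space.{k, u₁, v₁} K} {C₁ : C1Space.{k, u₁, v₁} K} {E₂ : C1Space.{k, u₂, v₂} K}
    {A₃ : C1Space.{k, u₃, v₃} K} {E₃ : C1Space.{k, u₃, v₃} K} {C₃ : C1Space.{k, u₃, v₃} K}
    {α : E₁.V →ₗ[K] E₂.V} {β : E₂.V →ₗ[K] E₃.V} {α₁ : A₁.V →ₗ[K] E₁.V} {β₁ : E₁.V →ₗ[K] C₁.V}
    {α₃ : A₃.V →ₗ[K] E₃.V} {β₃ : E₃.V →ₗ[K] C₃.V} (h : C1Admissible E₁ E₂ E₃ α β)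
    (h₁ : C1Admissible A₁ E₁ C₁ α₁ β₁) (h₃ : C1Admissible A₃ E₃ C₃ α₃ β₃) [Subsingleton C₁.V]
    [Subsingleton A₃.V] {m : Meas A₁} {n : Meas E₁.dual} {M₁ : Meas C₁.dual} {e₁ : Meas A₁.dual}
    (he₁ : e₁ ≠ 0) {r₁ : ℂ} (hr₁ : r₁ = 1) (H₁ : pair m e₁ • n = r₁ • h₁.dual.prod M₁ e₁) {x : Meas A₃}
    {d : Meas E₃.dual} {M₃ : Meas C₃.dual} {e₃ : Meas A₃.dual} (he₃ : e₃ ≠ 0) {r₃ : ℂ}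
    (hr₃ : r₃ = 1) (H₃ : pair x e₃ • d = r₃ • h₃.dual.prod M₃ e₃) (f : TestFun E₂.dual) :
    mass x * m.1 (h₁.res (h.res (fourierTest hψ E₂ (h.dual.prod d n) f))) =
      mass M₁ * M₃.1 (h₃.dual.res (h.dual.res f)) := by
  subst hr₁ hr₃
  rw [h.res_fourierTest, h₁.apply_res_fourierTest hψ he₁ H₁, h.dual.push_zero]
  linear_combination mass M₁ * h₃.mass_mul_apply he₃ H₃ (h.dual.res f)

end

/-! ### The characteristic distribution at a level -/

namespace SysTriple

variable {S₁ : C1System.{k, u₁, v₁, w₁} K} {S₂ : C1System.{k, u₂, v₂, w₂} K}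
    {S₃ : C1System.{k, u₃, v₃, w₃} K} (T : SysTriple S₁ S₂ S₃) {o : S₂.ι} {t : S₁.ι} {s : S₃.ι}

/-- Transporting 1_m down from the level `(o, t)` multiplies the measure m_o a by a measure on F o /
F l. The compatibility of the components of a virtual measure says that this product is the
component of `m` at `l`. -/
theorem transition_oneDist {S : C1System.{k, u, v, w} K} {o t : S.ι} (h : o ≤ t) (m : S.VM o t)
    (q : S.Level o) (hq : C1System.mkLevel le_rfl h ≤ q) (ht : t ≤ q.hi)
    (a : Meas (S.obj q.lo_le)) :
    C1System.transition (C1System.mkLevel le_rfl h) q hq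
        ((Meas (S.obj h)).subtype ∘ₗ m.1 ⟨o, le_rfl, h⟩) a =
      (m.1 ⟨q.lo, q.lo_le, q.lo_le.trans h⟩ a).1 ∘ₗ (S.adm (q.lo_le.trans h) ht).res := by
  -- Both sides are made into linear maps of `a`, so that they need only be compared on products `c
  -- ⊗ a` with `a ∈ μ(F o / F o)`, where the transition map is known.
  refine LinearMap.congr_fun (f := C1System.transition _ q hq _)
    (g := LinearMap.lcomp ℂ ℂ (S.adm (q.lo_le.trans h) ht).res ∘ₗ
      (Meas (S.obj (q.lo_le.trans h))).subtype ∘ₗ m.1 ⟨q.lo, q.lo_le, q.lo_le.trans h⟩) ?_ a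
  refine (S.adm q.lo_le le_rfl).hom_ext fun c a => ?_
  refine (C1System.transition_prod _ q hq _ c a).trans ?_
  exact congrArg (fun m : Meas (S.obj (q.lo_le.trans h)) => m.1 ∘ₗ (S.adm (q.lo_le.trans h) ht).res)
    (m.2 _ _ q.lo_le le_rfl h c a).symm

/-- The characteristic distribution is represented at every level `(l, i)` with `F₃ (γ l) = {0}` and
`F₁ (ε i) = V₁`, by the functional `a₁ ⊗ a₃ ↦ ν a₃ • μ a₁` on `μ(F₂ o / F₂ l)`. -/
theorem charDist_eq_of (ht : T.ε o ≤ t) (hs : S₃.IsZeroAt s) (μ : S₁.VM (T.ε o) t)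
    (ν : S₃.VM (T.γ o) s) (p : S₂.Level o) (hp : T.γ p.lo ≤ s) (hp' : t ≤ T.ε p.hi) :
    ∃ Φ : S₂.LevelDist o p, T.charDist ht hs μ ν = C1System.Dist.of p Φ ∧
      ∀ a₁ a₃, Φ ((T.adm p.lo_le).prod a₁ a₃) =
        mass (ν.1 ⟨T.γ p.lo, T.γ_mono p.lo_le, hp⟩ a₃) •
          (((μ.1 ⟨T.ε p.lo, T.ε_mono p.lo_le, (T.ε_mono p.lo_le).trans ht⟩ a₁).1 ∘ₗ
            (S₁.adm ((T.ε_mono p.lo_le).trans ht) hp').res) ∘ₗ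
              (T.adm (p.lo_le.trans p.le_hi)).res) := by
  -- The image of `p` lies above the level `(ε o, t)` at which 1_μ is given, so the direct image can
  -- be computed at `p` itself.
  have h : C1System.mkLevel le_rfl ht ≤ T.lev p := ⟨T.ε_mono p.lo_le, hp'⟩
  refine ⟨_, T.alphaStar_of ν hs _ p h hp _, fun a₁ a₃ => ?_⟩
  refine (T.pushLevel_prod p.lo_le p.le_hi _ _ _ _).trans ?_
  exact congrArg (fun G : Distr (S₁.obj (T.ε_mono (p.lo_le.trans p.le_hi))) =>
    mass (ν.1 ⟨T.γ p.lo, T.γ_mono p.lo_le, hp⟩ a₃) • (G ∘ₗ (T.adm (p.lo_le.trans p.le_hi)).res))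
    (transition_oneDist ht μ (T.lev p) h hp' a₁)

/-! ### The Poisson formula at a level and in the limit -/

variable {ψ : AddChar K ℂ} (hψ : ψ ≠ 1)

/-- On the left μ gives the measure that is integrated and ν a number; on the right their roles are
exchanged. The exchange comes from the relations between the components of μ and ν at `l` and those
of their duals at `i`. -/
theorem apply_fourierTest_eq (ht : S₁.IsTotalAt t) (hs : S₃.IsZeroAt s) {l i : S₂.ι} (hl : l ≤ o)
    (hi : o ≤ i) (hlt : T.ε l ≤ t) (hti : t ≤ T.ε i)
    (hls : T.γ l ≤ s) (hsi : s ≤ T.γ i) (μ : S₁.VM (T.ε o) t) (ν : S₃.VM (T.γ o) s)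
    {a₁ : Meas (S₁.obj (T.ε_mono hl))} {b₁' : Meas (S₁.obj (T.ε_mono hl)).dual}
    (h₁ : pair a₁ b₁' = 1) {a₃ : Meas (S₃.obj (T.γ_mono hl))}
    {b₃' : Meas (S₃.obj (T.γ_mono hl)).dual} (h₃ : pair a₃ b₃' = 1)
    (b₁ : Meas (S₁.obj (T.ε_mono hi)).dual) (b₃ : Meas (S₃.obj (T.γ_mono hi)).dual)
    (f : TestFun (S₂.obj (hl.trans hi)).dual) :
    mass (ν.1 ⟨T.γ l, T.γ_mono hl, hls⟩ a₃) *
        (μ.1 ⟨T.ε l, T.ε_mono hl, hlt⟩ a₁).1 ((S₁.adm hlt hti).res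
          ((T.adm (hl.trans hi)).res (fourierTest hψ (S₂.obj (hl.trans hi))
            ((T.adm (hl.trans hi)).dual.prod
              ((S₃.adm (T.γ_mono hl) (T.γ_mono hi)).dual.prod b₃ b₃')
              ((S₁.adm (T.ε_mono hl) (T.ε_mono hi)).dual.prod b₁ b₁')) f))) =
      mass ((C1System.VM.dual μ).1 ⟨C1System.op (T.ε i), T.ε_mono hi, hti⟩ b₁) *
        ((C1System.VM.dual ν).1 ⟨C1System.op (T.γ i), T.γ_mono hi, hsi⟩ b₃).1
          ((S₃.adm hls hsi).dual.res ((T.adm (hl.trans hi)).dual.res f)) := by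
  have i₁ : Subsingleton (S₁.obj hti).V := ht _ hti
  have i₃ : Subsingleton (S₃.obj hls).V := hs _ hls
  have hp₁ := C1System.VM.dualRel_dual hψ μ (T.ε_mono hi) hti b₁ (T.ε l) (T.ε_mono hl) hlt a₁ b₁'
    (haar (S₁.obj hlt).dual)
  have hp₃ := C1System.VM.dualRel_dual hψ ν (T.γ_mono hi) hsi b₃ (T.γ l) (T.γ_mono hl) hls a₃ b₃'
    (haar (S₃.obj hls).dual)
  -- The pairings on the right of the two relations are those of `a₁`, `b₁'` and of `a₃`, `b₃'`,
  -- which equal 1 by `h₁` and `h₃`.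
  exact (T.adm (hl.trans hi)).mass_mul_apply_res_fourierTest hψ (S₁.adm hlt hti) (S₃.adm hls hsi)
    (haar_ne_zero _) h₁ hp₁ (haar_ne_zero _) h₃ hp₃ f

/-- This is the interchange law for the dual triple, which has the dual of F₁(ε i)/F₁(ε o) as a
corner. That space is in general not zero, so the full law is needed here. -/
theorem dual_prod_prod_prod_comm {l o i : S₂.ι} (hl : l ≤ o) (hi : o ≤ i)
    (b₃ : Meas (S₃.obj (T.γ_mono hi)).dual) (b₁ : Meas (S₁.obj (T.ε_mono hi)).dual)
    (b₃' : Meas (S₃.obj (T.γ_mono hl)).dual) (b₁' : Meas (S₁.obj (T.ε_mono hl)).dual) :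
    (S₂.adm hl hi).dual.prod ((T.adm hi).dual.prod b₃ b₁) ((T.adm hl).dual.prod b₃' b₁') =
      (T.adm (hl.trans hi)).dual.prod
        ((S₃.adm (T.γ_mono hl) (T.γ_mono hi)).dual.prod b₃ b₃')
        ((S₁.adm (T.ε_mono hl) (T.ε_mono hi)).dual.prod b₁ b₁') :=
  T.dual.prod_prod_prod_comm (C1System.op_le hi) (C1System.op_le hl) b₃ b₁ b₃' b₁'

/-- The Poisson formula at the level `(l, i)`. -/
theorem fourierAux_prod_apply (ht : S₁.IsTotalAt t) (hs : S₃.IsZeroAt s) {l i : S₂.ι} (hl : l ≤ o)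
    (hi : o ≤ i) (hlt : T.ε l ≤ t) (hti : t ≤ T.ε i) (hls : T.γ l ≤ s) (hsi : s ≤ T.γ i)
    (μ : S₁.VM (T.ε o) t) (ν : S₃.VM (T.γ o) s)
    (Φ : Meas (S₂.obj hl) →ₗ[ℂ] Distr (S₂.obj (hl.trans hi)))
    (hΦ : ∀ a₁ a₃, Φ ((T.adm hl).prod a₁ a₃) = mass (ν.1 ⟨T.γ l, T.γ_mono hl, hls⟩ a₃) •
      (((μ.1 ⟨T.ε l, T.ε_mono hl, hlt⟩ a₁).1 ∘ₗ (S₁.adm hlt hti).res) ∘ₗ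
        (T.adm (hl.trans hi)).res))
    {a₁ : Meas (S₁.obj (T.ε_mono hl))} {b₁' : Meas (S₁.obj (T.ε_mono hl)).dual}
    (h₁ : pair a₁ b₁' = 1) {a₃ : Meas (S₃.obj (T.γ_mono hl))}
    {b₃' : Meas (S₃.obj (T.γ_mono hl)).dual} (h₃ : pair a₃ b₃' = 1)
    (b₃ : Meas (S₃.obj (T.γ_mono hi)).dual) (b₁ : Meas (S₁.obj (T.ε_mono hi)).dual)
    (f : TestFun (S₂.obj (hl.trans hi)).dual) :
    C1System.fourierAux hψ hl hi Φ ((T.adm hi).dual.prod b₃ b₁) f =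
      mass ((C1System.VM.dual μ).1 ⟨C1System.op (T.ε i), T.ε_mono hi, hti⟩ b₁) *
        ((C1System.VM.dual ν).1 ⟨C1System.op (T.γ i), T.γ_mono hi, hsi⟩ b₃).1
          ((S₃.adm hls hsi).dual.res ((T.adm (hl.trans hi)).dual.res f)) := by
  have h := C1System.fourierAux_spec hψ hl hi Φ ((T.adm hi).dual.prod b₃ b₁)
    ((T.adm hl).prod a₁ a₃) ((T.adm hl).dual.prod b₃' b₁')
  -- The measures at `l` are chosen inverse to each other, so the normalising factor of `fourierAux`
  -- is 1. The measure on the dual of F₂(i)/F₂(l) is then regrouped along the triple.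
  rw [C1Admissible.pair_prod hψ, h₁, h₃, one_mul, one_smul, T.dual_prod_prod_prod_comm, hΦ] at h
  exact (LinearMap.congr_fun h f).symm.trans
    (T.apply_fourierTest_eq hψ ht hs hl hi hlt hti hls hsi μ ν h₁ h₃ b₁ b₃ f)

/-- The Poisson formula. -/
theorem fourier_charDist (ht : S₁.IsTotalAt t) (hot : T.ε o ≤ t) (hs : S₃.IsZeroAt s)
    (hso : s ≤ T.γ o) (μ : S₁.VM (T.ε o) t) (ν : S₃.VM (T.γ o) s) :
    C1System.fourier hψ o (T.charDist hot hs μ ν) =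
      T.dual.charDist (o := C1System.op o) (C1System.op_le hso) ht.dual (C1System.VM.dual ν)
        (C1System.VM.dual μ) := by
  -- One level serves both sides: the conditions `t ≤ ε p.hi` and `γ p.lo ≤ s` are the two
  -- conditions for `p.dual` in the dual triple, exchanged.
  obtain ⟨p, hp', hp⟩ := T.exists_level (C1System.mkLevel le_rfl hot) s
  replace hp' : t ≤ T.ε p.hi := hp'.2
  obtain ⟨Φ, h1, hΦ⟩ := T.charDist_eq_of hot hs μ ν p hp hp'
  obtain ⟨Φ', h2, hΦ'⟩ := T.dual.charDist_eq_of (o := C1System.op o) (C1System.op_le hso) ht.dual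
    (C1System.VM.dual ν) (C1System.VM.dual μ) p.dual hp' hp
  rw [h1, h2]
  refine (C1System.Dist.lift_of _ _ p Φ).trans (congrArg (C1System.Dist.of p.dual) ?_)
  -- The two representatives are linear maps on a line of measures, so it is enough to compare them
  -- at one nonzero product.
  have hb : (T.adm p.le_hi).dual.prod (haar _) (haar _) ≠ 0 :=
    C1Admissible.prod_ne_zero _ (haar_ne_zero _) (haar_ne_zero _)
  refine Meas.hom_ext hb (Eq.trans (LinearMap.ext fun f => ?_) (hΦ' (haar _) (haar _)).symm)
  exact T.fourierAux_prod_apply hψ ht hs p.lo_le p.le_hi ((T.ε_mono p.lo_le).trans hot) hp' hp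
    (hso.trans (T.γ_mono p.le_hi)) μ ν Φ hΦ
    (pair_haarInv _) (pair_haarInv _) _ _ f

end SysTriple

end HarmonicC2

/-- Virtual measures, distributions and the transform depend only on the subquotients. The
conditions F₁(t) = V₁ and F₃(s) = 0 enter through the vanishing of the subquotients above `t` and
below `s`. -/
theorem mainTheorem1
    {K : Type k} [Field K] [Finite K] {ψ : AddChar K ℂ} (hψ : ψ ≠ 1)
    {V₁ : Type u₁} {V₂ : Type u₂} {V₃ : Type u₃} [AddCommGroup V₁] [Module K V₁]
    [AddCommGroup V₂] [Module K V₂] [AddCommGroup V₃] [Module K V₃]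
    (E₁ : C2Structure.{k, u₁, v₁, w₁} K V₁)
    (E₂ : C2Structure.{k, u₂, v₂, w₂} K V₂)
    (E₃ : C2Structure.{k, u₃, v₃, w₃} K V₃)
    (hE₁ : E₁.IsComplete) (hE₂ : E₂.IsComplete) (hE₃ : E₃.IsComplete)
    (α : V₁ →ₗ[K] V₂) (β : V₂ →ₗ[K] V₃) (T : C2Triple E₁ E₂ E₃ α β)
    (o : E₂.I)
    (t : E₁.I) (ht : E₁.F t = ⊤) (hot : T.ε o ≤ t)
    (s : E₃.I) (hs : E₃.F s = ⊥) (hso : s ≤ T.γ o)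
    (μ : E₁.sys.VM (T.ε o) t) (ν : E₃.sys.VM (T.γ o) s) :
    C1System.fourier (S := E₂.sys) hψ o
        (T.sys.charDist (o := o) hot (C2Structure.isZeroAt hs) μ ν) =
      T.sys.dual.charDist (o := C1System.op o) (C1System.op_le hso)
        (C2Structure.isTotalAt ht).dual (C1System.VM.dual ν) (C1System.VM.dual μ) :=
  T.sys.fourier_charDist hψ (C2Structure.isTotalAt ht) hot (C2Structure.isZeroAt hs) hso μ ν
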